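/- **Theorem 3.1 (Fay identity).** Let $t=(t_1,t_2,t_3,\dots)$ be real variables and $n\in\mathbb Z$; all functions of $(n,t)$ are real- or complex-valued and smooth in $t$ (jointly $C^\infty$ in any finite number of the times, the others being fixed). The sequences $t$ range over a set $U\subseteq\mathbb R^{\infty}$, for instance all of $\mathbb R^\infty$, such that all the sections of $U$ obtained by fixing all but finitely many of the times are open. Let $\Delta f(n)=f(n+1)-f(n)$, and let pseudo-difference operators $\sum_{i\le m}a_i(n,t)\Delta^i$ be composed by the rule $$\Delta^k\circ g=\sum_{i\ge 0}\binom ki(\Delta^i g)(n+k-i)\,\Delta^{k-i}\qquad(k\in\mathbb Z).$$ For $A=\sum_i a_i\Delta^i$ put $A_{\ge1}=\sum_{i\ge1}a_i\Delta^i$ and $A_{\le0}=\sum_{i\le0}a_i\Delta^i$. Let $L=Z\Delta Z^{-1}$, with $Z=z_0+z_1\Delta^{-1}+z_2\Delta^{-2}+\cdots$ and $z_0$ nowhere zero, be a solution of the discrete modified KP (dmKP) hierarchy with dressing operator $Z$, that is, $$\frac{\partial L}{\partial t_k}=[(L^k)_{\ge1},L],\qquad \frac{\partial Z}{\partial t_k}=-(L^k)_{\le0}\,Z\qquad(k=1,2,3,\dots).$$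 Put $\xi(t,\lambda)=\sum_{k\ge1}t_k\lambda^k$ and $[s]=(s,s^2/2,s^3/3,\dots)$. For formal variables $s_i$ and signs $\varepsilon_i\in\{1,-1\}$, the expression $f(n,t+\sum_i\varepsilon_i[s_i])$ denotes the formal Taylor expansion $$\exp\Big(\sum_i\sum_{k\ge1}\varepsilon_i\frac{s_i^k}{k}\frac{\partial}{\partial t_k}\Big)f(n,t),$$ a formal power series in the $s_i$ whose coefficients are functions of $(n,t)$. Let $\tau_0(n,t)$ and $\tau_1(n,t)$ be tau functions of this solution: smooth, nowhere vanishing functions such that the wave function $w(n,t,\lambda)=Z\big((1+\lambda)^ne^{\xi(t,\lambda)}\big)=\big(\sum_{j\ge0}z_j(n,t)\lambda^{-j}\big)(1+\lambda)^ne^{\xi(t,\lambda)}$ is $$w(n,t,\lambda)=\frac{\tau_0(n,t-[\lambda^{-1}])}{\tau_1(n,t)}(1+\lambda)^ne^{\xi(t,\lambda)}.$$ Then, as an identity of formal power series in $s_0,s_1,s_2,s_3$ whose coefficients are functions of $(n,t)$, $$\begin{aligned} &s_1(s_0-s_1)(s_2-s_3)\,\tau_0(n,t+[s_2]+[s_3])\,\tau_1(n,t+[s_0]+[s_1])\\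 &\quad+s_2(s_0-s_2)(s_3-s_1)\,\tau_0(n,t+[s_3]+[s_1])\,\tau_1(n,t+[s_0]+[s_2])\\ &\quad+s_3(s_0-s_3)(s_1-s_2)\,\tau_0(n,t+[s_1]+[s_2])\,\tau_1(n,t+[s_0]+[s_3])\\ &=(s_1-s_2)(s_2-s_3)(s_3-s_1)\,\tau_0(n,t+[s_0])\,\tau_1(n,t+[s_1]+[s_2]+[s_3]). \end{aligned}$$ -/

import Mathlib

noncomputable section

namespace DMKP

/-- The space of all sequences of times `t = (t₁, t₂, t₃, …)` with real entries. -/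
abbrev Times : Type := ℕ+ → ℝ

/-- An admissible domain of times: whenever all but finitely many of the times are frozen, the
remaining ones vary in an open set (for example: all sequences, all finitely supported sequences,
or the part of these where finitely many given continuous functions do not vanish). -/
def IsTimeDomain (U : Set Times) : Prop :=
  ∀ t ∈ U, ∀ S : Finset ℕ+, IsOpen {x : S → ℝ | Function.updateFinset t S x ∈ U}

/-- Functions `f(n, t)` of a discrete variable `n ∈ ℤ` and of the times `t ∈ U`, with the pointwise
ring structure. -/
abbrev DFun (U : Set Times) (𝕜 : Type*) : Type _ := ℤ → U → 𝕜

section Functions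

variable {U : Set Times} {𝕜 : Type*} [RCLike 𝕜]

/-- Extension by zero to all sequences of times (only the values on `U` matter below). -/
def ext₀ (f : U → 𝕜) : Times → 𝕜 := Function.extend Subtype.val f 0

/-- `f(n, t)` is smooth in `t`: for all `n`, it is jointly `C^∞` in any finite number of times,
the other times being frozen. -/
def SmoothFn (f : DFun U 𝕜) : Prop :=
  ∀ n : ℤ, ∀ t ∈ U, ∀ S : Finset ℕ+,
    ContDiffOn ℝ ((⊤ : ℕ∞) : WithTop ℕ∞)
      (fun x : S → ℝ => ext₀ (f n) (Function.updateFinset t S x))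
      {x : S → ℝ | Function.updateFinset t S x ∈ U}

/-- The partial derivative `∂f/∂t_k`. -/
def pd (k : ℕ+) (f : DFun U 𝕜) : DFun U 𝕜 :=
  fun n t => deriv (fun x : ℝ => ext₀ (f n) (Function.update (t : Times) k x)) ((t : Times) k)

/-- The iterated derivative `∂_{k₁} ∂_{k₂} ⋯ ∂_{k_m} f` along the list `[k₁, …, k_m]`. -/
def pdList (l : List ℕ+) (f : DFun U 𝕜) : DFun U 𝕜 := l.foldr pd f

/-- The power `Γ^m` of the shift operator: `(Γ^m f)(n) = f(n + m)`. -/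
def shift (m : ℤ) (f : DFun U 𝕜) : DFun U 𝕜 := fun n => f (n + m)

/-- The difference operator `(Δ f)(n) = f(n + 1) - f(n)`. -/
def diff (f : DFun U 𝕜) : DFun U 𝕜 := fun n => f (n + 1) - f n

/-- The displacement `[s_i] = (s_i, s_i²/2, s_i³/3, …)` of the times, where `s_i` is a formal
variable. -/
def bracket {σ : Type*} (i : σ) : ℕ+ → MvPowerSeries σ ℝ :=
  fun k => MvPowerSeries.C (1 / ((k : ℕ) : ℝ)) * MvPowerSeries.X i ^ (k : ℕ)

/-- `f(n, t + y)` for a formal displacement `y = (y₁, y₂, …)` whose components are formal power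
series: the formal Taylor expansion
`exp(∑ₖ yₖ ∂ₖ) f = ∑_m (1/m!) ∑_{k₁,…,k_m} y_{k₁} ⋯ y_{k_m} ∂_{k₁} ⋯ ∂_{k_m} f`,
a formal power series with coefficients functions of `(n, t)`. If `y` is a signed sum of brackets,
then only finitely many lists contribute to each coefficient. -/
def taylorShift {σ : Type*} (f : DFun U 𝕜) (y : ℕ+ → MvPowerSeries σ ℝ) :
    MvPowerSeries σ (DFun U 𝕜) :=
  fun d => ∑ᶠ l : List ℕ+,
    (((l.length.factorial : ℝ)⁻¹) * MvPowerSeries.coeff d (l.map y).prod) • pdList l f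

end Functions

/-- Pseudo-difference operators `∑_{i ≤ m} a_i(n, t) Δ^i`. -/
@[ext]
structure PDO (U : Set Times) (𝕜 : Type*) [RCLike 𝕜] where
  /-- The coefficient `a_i` of `Δ^i`. -/
  coeff : ℤ → DFun U 𝕜
  /-- The powers of `Δ` are bounded above. -/
  bdd : ∃ m : ℤ, ∀ i : ℤ, m < i → coeff i = 0

namespace PDO

variable {U : Set Times} {𝕜 : Type*} [RCLike 𝕜]

/-- The monomial `Δ^j`. -/
def deltaPow (j : ℤ) : PDO U 𝕜 where
  coeff := fun i => if i = j then 1 else 0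
  bdd := ⟨j, fun _ hi => if_neg hi.ne'⟩

instance : One (PDO U 𝕜) := ⟨deltaPow 0⟩

/-- Composition of operators, by the Leibniz rule
`Δ^i ∘ b = ∑_{r ≥ 0} binom(i, r) (Δ^r b)(n + i - r) Δ^{i - r}`:
the coefficient of `Δ^l` in `(∑ a_i Δ^i) ∘ (∑ b_j Δ^j)` collects the terms with
`j = l - i + r`, of which only finitely many are nonzero. -/
instance : Mul (PDO U 𝕜) where
  mul A B :=
    { coeff := fun l => ∑ᶠ p : ℤ × ℕ,
        Ring.choose p.1 p.2 •
          (A.coeff p.1 * shift (p.1 - p.2) (diff^[p.2] (B.coeff (l - p.1 + p.2))))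
      bdd := by
        obtain ⟨a, ha⟩ := A.bdd
        obtain ⟨b, hb⟩ := B.bdd
        refine ⟨a + b, fun l hl => finsum_eq_zero_of_forall_eq_zero fun p => ?_⟩
        by_cases h : a < p.1
        · rw [ha _ h, zero_mul, smul_zero]
        · have h0 : ∀ r : ℕ, (diff^[r] (0 : DFun U 𝕜)) = 0 := by
            intro r
            induction r with
            | zero => rfl
            | succ r ih =>
              rw [Function.iterate_succ_apply', ih]
              funext n
              simp [diff]
          have h1 : B.coeff (l - p.1 + p.2) = 0 := hb _ (by omega)
          have h2 : shift (p.1 - p.2) (0 : DFun U 𝕜) = 0 := rfl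
          rw [h1, h0, h2, mul_zero, smul_zero] }

/-- Powers `A^k = A ∘ ⋯ ∘ A`. -/
instance : Pow (PDO U 𝕜) ℕ := ⟨fun A k => npowRec k A⟩

/-- The part `A_{≥1} = ∑_{i ≥ 1} a_i Δ^i`. -/
def geOne (A : PDO U 𝕜) : PDO U 𝕜 where
  coeff := fun i => if 1 ≤ i then A.coeff i else 0
  bdd := by
    obtain ⟨m, hm⟩ := A.bdd
    exact ⟨m, fun i hi => by simp [hm i hi]⟩

/-- The part `A_{≤0} = ∑_{i ≤ 0} a_i Δ^i`. -/
def leZero (A : PDO U 𝕜) : PDO U 𝕜 where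
  coeff := fun i => if i ≤ 0 then A.coeff i else 0
  bdd := by
    obtain ⟨m, hm⟩ := A.bdd
    exact ⟨m, fun i hi => by simp [hm i hi]⟩

end PDO

section Hierarchy

variable {U : Set Times} {𝕜 : Type*} [RCLike 𝕜]

/-- The Lax equations `∂L/∂t_k = [(L^k)_{≥1}, L]`, `k = 1, 2, 3, …`. -/
def LaxEquations (L : PDO U 𝕜) : Prop :=
  ∀ (k : ℕ+) (j : ℤ), pd k (L.coeff j) =
    ((L ^ (k : ℕ)).geOne * L).coeff j - (L * (L ^ (k : ℕ)).geOne).coeff j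

/-- The Sato equations `∂Z/∂t_k = -(L^k)_{≤0} ∘ Z`, `k = 1, 2, 3, …`. -/
def SatoEquations (L Z : PDO U 𝕜) : Prop :=
  ∀ (k : ℕ+) (j : ℤ), pd k (Z.coeff j) = -((L ^ (k : ℕ)).leZero * Z).coeff j

/-- A solution of the discrete modified KP hierarchy: a Lax operator `L = Z ∘ Δ ∘ Z⁻¹` with
dressing operator `Z = z₀ + z₁ Δ⁻¹ + z₂ Δ⁻² + ⋯`, whose coefficients are smooth and whose leading
coefficient `z₀` does not vanish. (`Zinv` is the inverse `Z⁻¹` of `Z`.) -/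
structure IsSolution (L Z Zinv : PDO U 𝕜) : Prop where
  order_le_zero : ∀ i : ℤ, 0 < i → Z.coeff i = 0
  smooth : ∀ i : ℤ, SmoothFn (Z.coeff i)
  leading_ne_zero : ∀ n t, Z.coeff 0 n t ≠ 0
  mul_inv : Z * Zinv = 1
  inv_mul : Zinv * Z = 1
  dressing : L = Z * PDO.deltaPow 1 * Zinv
  lax : LaxEquations L
  sato : SatoEquations L Z

/-- The series `ŵ(n, t, λ) = z₀ + z₁ λ⁻¹ + z₂ λ⁻² + ⋯`, as a formal power series in `λ⁻¹`.
Since `Δ^{-j} (1 + λ)^n = λ^{-j} (1 + λ)^n`, the wave function is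
`w(n, t, λ) = Z ((1 + λ)^n e^{ξ(t, λ)}) = ŵ(n, t, λ) (1 + λ)^n e^{ξ(t, λ)}`. -/
def waveHat (Z : PDO U 𝕜) : PowerSeries (DFun U 𝕜) :=
  PowerSeries.mk fun j => Z.coeff (-(j : ℤ))

/-- `τ₀, τ₁` are tau functions of the solution with dressing operator `Z`: they are smooth, without
zeros, and the wave function is
`w(n, t, λ) = (τ₀(n, t - [λ⁻¹]) / τ₁(n, t)) (1 + λ)^n e^{ξ(t, λ)}`,
that is, `ŵ(n, t, λ) = τ₀(n, t - [λ⁻¹]) / τ₁(n, t)` as formal power series in `λ⁻¹`.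
Here `τ₁⁻¹` is the pointwise inverse. -/
structure IsTauPair (Z : PDO U 𝕜) (τ₀ τ₁ : DFun U 𝕜) : Prop where
  smooth_zero : SmoothFn τ₀
  smooth_one : SmoothFn τ₁
  ne_zero_zero : ∀ n t, τ₀ n t ≠ 0
  ne_zero_one : ∀ n t, τ₁ n t ≠ 0
  wave : waveHat Z = PowerSeries.C τ₁⁻¹ * taylorShift τ₀ (-bracket ())

end Hierarchy

end DMKP

end

/-! The Sato equations say that `∂_k w = (L^k)_{≥1} w`, so each time derivative of the wave function
is a combination of the `Δ^j w` with `j ≥ 1`, and so are the iterated ones. Hence in `w(n, t - [s],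
λ) = exp(-∑ s^k/k ∂_k) w` every coefficient of `s^m` with `m ≥ 1` is such a combination. On the
other hand `e^{ξ(t - [s], λ)} = (1 - sλ) e^{ξ(t, λ)}`, so these coefficients have degree at most one
in `λ`. As the `Δ^j w` have distinct degrees and invertible leading coefficients, only `Δw`
survives. Writing `ŵ` for the series in `x = λ⁻¹` and `y = s`, this is the linear problem `x ŵ(t, x)
- (x - y) ŵ(t - [y], x) = y z₀(t - [y]) E(x)`, where `E` is `Δw` normalized to leading coefficient
`1` (`exists_linear_problem`).

Putting `y = x` gives `E(x) = τ₁(t - [x]) / τ₁(t)` (`negShiftCoeff_eq_mul`). Substituting the tau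
functions, clearing denominators and shifting the base point yields, for every formal base point `B`
(`three_term_identity`), `(x - y) τ₀(B) τ₁(B + [x] + [y]) = x τ₀(B + [y]) τ₁(B + [x]) - y τ₀(B +
[x]) τ₁(B + [y])`.

The Fay identity is an algebraic consequence of six instances at `B = 0` and two at `B = [s₃]`, `B =
[s₁]` (`fay_elimination`). They imply the three-term relation for `τ₀` alone and the case `s₀ = 0`
of the Fay identity; the instances containing `s₀` then give the general case. The cancellations
take place in power series over a field, after evaluation at `(n, t)`.

Formal Taylor shifts are treated modulo series of order `N`, for all `N`: there `∑ y_k ∂_k` is a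
nilpotent derivation, and its exponential is a multiplicative map. -/

noncomputable section

namespace DMKP

set_option linter.unusedSectionVars false

/-! ### Pseudo-difference operators: associativity and the dressing of `Δ^k` -/

section Operators

variable {U : Set Times} {𝕜 : Type*} [RCLike 𝕜]

theorem shift_zero_fn (m : ℤ) : shift m (0 : DFun U 𝕜) = 0 := rfl

theorem shift_mul (m : ℤ) (f g : DFun U 𝕜) : shift m (f * g) = shift m f * shift m g := rfl

theorem shift_zsmul (m c : ℤ) (f : DFun U 𝕜) : shift m (c • f) = c • shift m f := rfl

theorem shift_shift (m k : ℤ) (f : DFun U 𝕜) : shift m (shift k f) = shift (m + k) f := by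
  funext n
  simp [shift, add_assoc]

theorem shift_zero_left (f : DFun U 𝕜) : shift 0 f = f := by
  funext n
  simp [shift]

theorem diff_eq (f : DFun U 𝕜) : diff f = shift 1 f - f := rfl

theorem diff_zero_fn : diff (0 : DFun U 𝕜) = 0 := by simp [diff_eq, shift_zero_fn]

theorem diff_zsmul (c : ℤ) (f : DFun U 𝕜) : diff (c • f) = c • diff f := by
  simp only [diff_eq, shift_zsmul, smul_sub]

theorem diff_shift (m : ℤ) (f : DFun U 𝕜) : diff (shift m f) = shift m (diff f) := by
  rw [diff_eq, shift_shift, add_comm, ← shift_shift]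
  rfl

theorem diff_mul (f g : DFun U 𝕜) : diff (f * g) = shift 1 f * diff g + diff f * g := by
  simp only [diff_eq, shift_mul]; ring

theorem iterate_diff_zero (r : ℕ) : diff^[r] (0 : DFun U 𝕜) = 0 :=
  Function.iterate_fixed diff_zero_fn r

theorem shift_sum {ι : Type*} (m : ℤ) (s : Finset ι) (f : ι → DFun U 𝕜) :
    shift m (∑ i ∈ s, f i) = ∑ i ∈ s, shift m (f i) := by
  funext n
  simp [shift, Finset.sum_apply]

theorem diff_sum {ι : Type*} (s : Finset ι) (f : ι → DFun U 𝕜) :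
    diff (∑ i ∈ s, f i) = ∑ i ∈ s, diff (f i) := by
  simp only [diff_eq, shift_sum, Finset.sum_sub_distrib]

/-- The coefficients of `Δ^i ∘ X`. -/
def deltaComp (i : ℤ) (X : ℤ → DFun U 𝕜) (l : ℤ) : DFun U 𝕜 :=
  ∑ᶠ r : ℕ, Ring.choose i r • shift (i - r) (diff^[r] (X (l - i + r)))

theorem deltaComp_eq_sum {X : ℤ → DFun U 𝕜} {x i l : ℤ} (hX : ∀ l, x < l → X l = 0) {R : ℕ}
    (hR : x < l - i + R) :
    deltaComp i X l =
      ∑ r ∈ Finset.range R, Ring.choose i r • shift (i - r) (diff^[r] (X (l - i + r))) := by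
  refine finsum_eq_sum_of_support_subset _ fun r hr => ?_
  by_contra h
  refine hr ?_
  simp only [Finset.coe_range, Set.mem_Iio, not_lt] at h
  simp only
  rw [hX _ (by omega), iterate_diff_zero, shift_zero_fn, smul_zero]

theorem deltaComp_eq_zero {X : ℤ → DFun U 𝕜} {x i l : ℤ} (hX : ∀ l, x < l → X l = 0)
    (h : x < l - i) : deltaComp i X l = 0 := by
  rw [deltaComp_eq_sum hX (R := 0) (by simpa using h), Finset.sum_range_zero]

theorem deltaComp_zero {X : ℤ → DFun U 𝕜} {x : ℤ} (hX : ∀ l, x < l → X l = 0) :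
    deltaComp 0 X = X := by
  funext l
  have hR : x < l - 0 + ((x - l).toNat + 1 : ℕ) := by omega
  rw [deltaComp_eq_sum hX hR, Finset.sum_range_succ', Finset.sum_eq_zero]
  · simp [shift_zero_left]
  · intro r _
    rw [Ring.choose_zero_succ, zero_smul]

/-- Pascal's rule splits `binom(i+1, r+1)`; the two halves are the two terms of `Δ ∘ f = f(n+1) Δ +
(Δf)`. -/
theorem deltaComp_add_one {X : ℤ → DFun U 𝕜} {x : ℤ} (hX : ∀ l, x < l → X l = 0) (i l : ℤ) :
    deltaComp (i + 1) X l = shift 1 (deltaComp i X (l - 1)) + diff (deltaComp i X l) := by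
  obtain ⟨R, hR⟩ : ∃ R : ℕ, x < l - (i + 1) + R := ⟨(x - l + i + 1).toNat + 1, by omega⟩
  rw [deltaComp_eq_sum hX (R := R + 1) (by push_cast; omega),
    deltaComp_eq_sum hX (i := i) (R := R + 1) (l := l - 1) (by push_cast; omega),
    deltaComp_eq_sum hX (i := i) (R := R) (by omega), shift_sum, diff_sum,
    Finset.sum_range_succ', Finset.sum_range_succ', add_right_comm, ← Finset.sum_add_distrib]
  congr 1
  · refine Finset.sum_congr rfl fun r _ => ?_
    rw [Ring.choose_succ_succ, shift_zsmul, diff_zsmul, shift_shift, diff_shift,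
      ← Function.iterate_succ_apply' diff, add_comm (Ring.choose i r), add_smul]
    have e1 : i + 1 - ((r + 1 : ℕ) : ℤ) = i - r := by push_cast; ring
    have e2 : l - (i + 1) + ((r + 1 : ℕ) : ℤ) = l - i + r := by push_cast; ring
    have e3 : l - 1 - i + ((r + 1 : ℕ) : ℤ) = l - i + r := by push_cast; ring
    have e4 : 1 + (i - ((r + 1 : ℕ) : ℤ)) = i - r := by push_cast; ring
    rw [e1, e2, e3, e4]
  · simp only [Ring.choose_zero_right, shift_zsmul, shift_shift, Function.iterate_zero, id]
    congr 2
    · push_cast; ring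
    · congr 1; push_cast; ring

theorem deltaComp_one {X : ℤ → DFun U 𝕜} {x : ℤ} (hX : ∀ l, x < l → X l = 0) (l : ℤ) :
    deltaComp 1 X l = shift 1 (X (l - 1)) + diff (X l) := by
  rw [← zero_add (1 : ℤ), deltaComp_add_one hX, deltaComp_zero hX, zero_add]

namespace PDO

theorem mul_coeff (A B : PDO U 𝕜) (l : ℤ) :
    (A * B).coeff l = ∑ᶠ p : ℤ × ℕ,
      Ring.choose p.1 p.2 •
        (A.coeff p.1 * shift (p.1 - p.2) (diff^[p.2] (B.coeff (l - p.1 + p.2)))) := rfl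

/-- Groups the double sum of the product by the powers of `Δ` in `A`. The index set `s` is left free
so that sums for different coefficients can share one range. -/
theorem mul_coeff_eq_sum {A B : PDO U 𝕜} {a b l : ℤ} (ha : ∀ i, a < i → A.coeff i = 0)
    (hb : ∀ i, b < i → B.coeff i = 0) {s : Finset ℤ} (hs : Finset.Icc (l - b) a ⊆ s) :
    (A * B).coeff l = ∑ i ∈ s, A.coeff i * deltaComp i B.coeff l := by
  have hsupp : ∀ p : ℤ × ℕ, (¬ (p.1 ≤ a ∧ l - p.1 + p.2 ≤ b)) → Ring.choose p.1 p.2 •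
        (A.coeff p.1 * shift (p.1 - p.2) (diff^[p.2] (B.coeff (l - p.1 + p.2)))) = 0 := by
    intro p hp
    by_cases h : a < p.1
    · rw [ha _ h, zero_mul, smul_zero]
    · rw [hb _ (by omega), iterate_diff_zero, shift_zero_fn, mul_zero, smul_zero]
  rw [mul_coeff, finsum_curry]
  · have : ∀ i, ∑ᶠ r : ℕ, Ring.choose i r •
        (A.coeff i * shift (i - r) (diff^[r] (B.coeff (l - i + r)))) =
        A.coeff i * deltaComp i B.coeff l := by
      intro i
      have hfin : ∀ r : ℕ, r ∉ Finset.range ((b - l + i).toNat + 1) →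
          B.coeff (l - i + r) = 0 := by
        intro r hr
        simp only [Finset.mem_range, not_lt] at hr
        exact hb _ (by omega)
      rw [deltaComp_eq_sum hb (R := (b - l + i).toNat + 1) (by push_cast; omega),
        finsum_eq_sum_of_support_subset (s := Finset.range ((b - l + i).toNat + 1)), Finset.mul_sum]
      · exact Finset.sum_congr rfl fun r _ => (mul_smul_comm _ _ _).symm
      · intro r hr
        by_contra h
        refine hr ?_
        simp only
        rw [hfin r h, iterate_diff_zero, shift_zero_fn, mul_zero, smul_zero]
    simp only [this]
    refine finsum_eq_sum_of_support_subset _ fun i hi => ?_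
    by_contra h
    refine hi ?_
    have h' : i ∉ Finset.Icc (l - b) a := fun h' => h (hs h')
    simp only [Finset.mem_Icc, not_and_or, not_le] at h'
    rcases h' with h' | h'
    · simp only
      rw [deltaComp_eq_zero hb (by omega), mul_zero]
    · simp only
      rw [ha _ h', zero_mul]
  · refine Set.Finite.subset
      ((Finset.Icc (l - b) a ×ˢ Finset.range ((b - l + a).toNat + 1)).finite_toSet) fun p hp => ?_
    by_contra h
    refine hp (hsupp p fun hp' => h ?_)
    simp only [Finset.coe_product, Set.mem_prod, Finset.mem_coe, Finset.mem_Icc, Finset.mem_range]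
    omega

theorem deltaPow_mul_coeff (i : ℤ) (B : PDO U 𝕜) : (deltaPow i * B).coeff = deltaComp i B.coeff := by
  obtain ⟨b, hb⟩ := B.bdd
  funext l
  have h1 : ∀ j, i < j → (deltaPow i : PDO U 𝕜).coeff j = 0 := fun j hj => if_neg hj.ne'
  rw [mul_coeff_eq_sum h1 hb (s := insert i (Finset.Icc (l - b) i)) (Finset.subset_insert _ _),
    Finset.sum_eq_single_of_mem i (Finset.mem_insert_self _ _)]
  · simp [deltaPow]
  · intro j _ hj
    simp [deltaPow, hj]

theorem mul_bound {A B : PDO U 𝕜} {a b : ℤ} (ha : ∀ i, a < i → A.coeff i = 0)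
    (hb : ∀ i, b < i → B.coeff i = 0) (l : ℤ) (hl : a + b < l) : (A * B).coeff l = 0 := by
  rw [mul_coeff_eq_sum ha hb subset_rfl, Finset.Icc_eq_empty (by omega), Finset.sum_empty]

theorem deltaPow_add_one_mul (i : ℤ) (B : PDO U 𝕜) :
    deltaPow (i + 1) * B = deltaPow 1 * (deltaPow i * B) := by
  obtain ⟨b, hb⟩ := B.bdd
  have h1 : ∀ j, i < j → (deltaPow i : PDO U 𝕜).coeff j = 0 := fun j hj => if_neg hj.ne'
  ext1
  funext l
  rw [deltaPow_mul_coeff, deltaPow_mul_coeff, deltaComp_add_one hb, deltaComp_one (mul_bound h1 hb),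
    deltaPow_mul_coeff]

theorem deltaPow_zero_mul (B : PDO U 𝕜) : deltaPow 0 * B = B := by
  obtain ⟨b, hb⟩ := B.bdd
  ext1
  rw [deltaPow_mul_coeff, deltaComp_zero hb]

theorem deltaPow_one_mul_coeff (B : PDO U 𝕜) (l : ℤ) :
    (deltaPow 1 * B).coeff l = shift 1 (B.coeff (l - 1)) + diff (B.coeff l) := by
  obtain ⟨b, hb⟩ := B.bdd
  rw [deltaPow_mul_coeff, deltaComp_one hb]

/-- The coefficient of `Δ^{l+1}` in `Δ ∘ B` is the shift of `B_l` plus a term in `B_{l+1}`, so `B`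
is recovered from the top down. -/
theorem deltaPow_one_mul_injective :
    Function.Injective fun B : PDO U 𝕜 => deltaPow 1 * B := by
  intro A B h
  obtain ⟨a, ha⟩ := A.bdd
  obtain ⟨b, hb⟩ := B.bdd
  have key : ∀ (m : ℕ) (l : ℤ), max a b - m < l → A.coeff l = B.coeff l := by
    intro m
    induction m with
    | zero =>
      intro l hl
      rw [ha l (by simp at hl; omega), hb l (by simp at hl; omega)]
    | succ m ih =>
      intro l hl
      have h1 := congrArg (fun C : PDO U 𝕜 => C.coeff (l + 1)) h
      simp only [deltaPow_one_mul_coeff, add_sub_cancel_right,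
        ih (l + 1) (by push_cast at hl; omega), add_left_inj] at h1
      have h2 := congrArg (shift (-1)) h1
      simpa only [shift_shift, neg_add_cancel, shift_zero_left] using h2
  ext1
  funext l
  exact key ((max a b - l).toNat + 1) l (by push_cast; omega)

/-- Reduces to the product rule for `Δ` on functions together with `Δ ∘ Δ^i = Δ^{i+1}`; the rest is
matching summation ranges, outside of which all terms vanish. -/
theorem deltaPow_one_mul_assoc (B C : PDO U 𝕜) :
    deltaPow 1 * B * C = deltaPow 1 * (B * C) := by
  obtain ⟨b, hb⟩ := B.bdd
  obtain ⟨c, hc⟩ := C.bdd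
  have h1 : ∀ j : ℤ, 1 < j → (deltaPow 1 : PDO U 𝕜).coeff j = 0 := fun j hj => if_neg hj.ne'
  ext1
  funext l
  have hs : Finset.Icc (l - 1 - c) b ⊆ Finset.Icc (l - 1 - c) b := subset_rfl
  rw [deltaPow_one_mul_coeff,
    mul_coeff_eq_sum (mul_bound h1 hb) hc (s := Finset.Icc (l - 1 - c) (b + 1))
      (Finset.Icc_subset_Icc (by omega) (by omega)),
    mul_coeff_eq_sum hb hc (l := l - 1) (s := Finset.Icc (l - 2 - c) b)
      (Finset.Icc_subset_Icc (by omega) le_rfl),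
    mul_coeff_eq_sum hb hc (l := l) (s := Finset.Icc (l - 1 - c) (b + 1))
      (Finset.Icc_subset_Icc (by omega) (by omega)), shift_sum, diff_sum]
  have hr : Finset.Icc (l - 2 - c) b =
      (Finset.Icc (l - 1 - c) (b + 1)).map (Equiv.subRight (1 : ℤ)).toEmbedding := by
    ext j
    simp only [Finset.mem_Icc, Finset.mem_map_equiv, Equiv.subRight_symm_apply]
    omega
  have hr2 : ∑ i ∈ Finset.Icc (l - 2 - c) b, shift 1 (B.coeff i * deltaComp i C.coeff (l - 1)) =
      ∑ i ∈ Finset.Icc (l - 2 - c) (b + 1), shift 1 (B.coeff i * deltaComp i C.coeff (l - 1)) := by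
    refine Finset.sum_subset (Finset.Icc_subset_Icc le_rfl (by omega)) fun i hi hi' => ?_
    simp only [Finset.mem_Icc] at hi hi'
    rw [hb i (by omega), zero_mul, shift_zero_fn]
  have hr3 : ∑ i ∈ Finset.Icc (l - 2 - c) (b + 1),
        shift 1 (B.coeff i) * shift 1 (deltaComp i C.coeff (l - 1)) =
      ∑ i ∈ Finset.Icc (l - 1 - c) (b + 1),
        shift 1 (B.coeff i) * shift 1 (deltaComp i C.coeff (l - 1)) := by
    refine (Finset.sum_subset (Finset.Icc_subset_Icc (by omega) le_rfl) fun i hi hi' => ?_).symm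
    simp only [Finset.mem_Icc] at hi hi'
    rw [deltaComp_eq_zero hc (by omega), shift_zero_fn, mul_zero]
  have key : ∑ i ∈ Finset.Icc (l - 1 - c) (b + 1),
        shift 1 (B.coeff (i - 1)) * deltaComp i C.coeff l =
      ∑ i ∈ Finset.Icc (l - 1 - c) (b + 1), shift 1 (B.coeff i) *
        (shift 1 (deltaComp i C.coeff (l - 1)) + diff (deltaComp i C.coeff l)) := by
    have e : ∑ i ∈ Finset.Icc (l - 2 - c) b, shift 1 (B.coeff i) *
        (shift 1 (deltaComp i C.coeff (l - 1)) + diff (deltaComp i C.coeff l)) =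
        ∑ i ∈ Finset.Icc (l - 1 - c) (b + 1), shift 1 (B.coeff i) *
        (shift 1 (deltaComp i C.coeff (l - 1)) + diff (deltaComp i C.coeff l)) := by
      have e1 : ∑ i ∈ Finset.Icc (l - 2 - c) b, shift 1 (B.coeff i) *
          (shift 1 (deltaComp i C.coeff (l - 1)) + diff (deltaComp i C.coeff l)) =
          ∑ i ∈ Finset.Icc (l - 2 - c) (b + 1), shift 1 (B.coeff i) *
          (shift 1 (deltaComp i C.coeff (l - 1)) + diff (deltaComp i C.coeff l)) := by
        refine Finset.sum_subset (Finset.Icc_subset_Icc le_rfl (by omega)) fun i hi hi' => ?_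
        simp only [Finset.mem_Icc] at hi hi'
        rw [hb i (by omega), shift_zero_fn, zero_mul]
      rw [e1]
      refine (Finset.sum_subset (Finset.Icc_subset_Icc (by omega) le_rfl) fun i hi hi' => ?_).symm
      simp only [Finset.mem_Icc] at hi hi'
      rw [deltaComp_eq_zero hc (by omega), deltaComp_eq_zero hc (by omega), shift_zero_fn,
        diff_zero_fn, add_zero, mul_zero]
    rw [← e, hr, Finset.sum_map]
    refine Finset.sum_congr rfl fun i _ => ?_
    simp only [Equiv.coe_toEmbedding, Equiv.subRight_apply]
    rw [← deltaComp_add_one hc, sub_add_cancel]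
  simp only [deltaPow_one_mul_coeff, add_mul, Finset.sum_add_distrib, diff_mul]
  rw [key, hr2]
  simp only [shift_mul]
  rw [hr3]
  simp only [mul_add, Finset.sum_add_distrib]
  ring

/-- Induction in both directions from `i = 0`; downwards, a factor `Δ` is cancelled on the left. -/
theorem deltaPow_mul_assoc (i : ℤ) (B C : PDO U 𝕜) :
    deltaPow i * B * C = deltaPow i * (B * C) := by
  induction i using Int.induction_on with
  | zero => simp only [deltaPow_zero_mul]
  | succ i ih => rw [deltaPow_add_one_mul, deltaPow_one_mul_assoc, ih, ← deltaPow_add_one_mul]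
  | pred i ih =>
    apply deltaPow_one_mul_injective
    simp only
    rw [← deltaPow_one_mul_assoc, ← deltaPow_add_one_mul, ← deltaPow_add_one_mul, sub_add_cancel, ih]

/-- Multiplying by a function on the left acts on coefficients termwise, so it suffices to treat
each power `Δ^i` of the first factor. -/
protected theorem mul_assoc (A B C : PDO U 𝕜) : A * B * C = A * (B * C) := by
  obtain ⟨a, ha⟩ := A.bdd
  obtain ⟨b, hb⟩ := B.bdd
  obtain ⟨c, hc⟩ := C.bdd
  ext1
  funext l
  have hd : ∀ i j, i < j → (deltaPow i : PDO U 𝕜).coeff j = 0 := fun i j hj => if_neg hj.ne'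
  rw [mul_coeff_eq_sum (mul_bound ha hb) hc subset_rfl,
    mul_coeff_eq_sum ha (mul_bound hb hc) subset_rfl]
  have h1 : ∀ k ∈ Finset.Icc (l - c) (a + b), (A * B).coeff k * deltaComp k C.coeff l =
      ∑ i ∈ Finset.Icc (l - (b + c)) a,
        A.coeff i * (deltaComp i B.coeff k * deltaComp k C.coeff l) := by
    intro k hk
    simp only [Finset.mem_Icc] at hk
    rw [mul_coeff_eq_sum ha hb (s := Finset.Icc (l - (b + c)) a)
      (Finset.Icc_subset_Icc (by omega) le_rfl), Finset.sum_mul]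
    exact Finset.sum_congr rfl fun i _ => mul_assoc _ _ _
  rw [Finset.sum_congr rfl h1, Finset.sum_comm]
  refine Finset.sum_congr rfl fun i hi => ?_
  simp only [Finset.mem_Icc] at hi
  rw [← Finset.mul_sum, ← deltaPow_mul_coeff i (B * C), ← deltaPow_mul_assoc,
    mul_coeff_eq_sum (mul_bound (hd i) hb) hc (s := Finset.Icc (l - c) (a + b))
      (Finset.Icc_subset_Icc le_rfl (by omega)), deltaPow_mul_coeff]

theorem mul_deltaPow_coeff (A : PDO U 𝕜) (k l : ℤ) :
    (A * deltaPow k).coeff l = A.coeff (l - k) := by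
  obtain ⟨a, ha⟩ := A.bdd
  have hd : ∀ j, k < j → (deltaPow k : PDO U 𝕜).coeff j = 0 := fun j hj => if_neg hj.ne'
  have hdiff : ∀ r : ℕ, diff^[r + 1] (1 : DFun U 𝕜) = 0 := by
    intro r
    have : diff (1 : DFun U 𝕜) = 0 := by funext n; simp [diff]
    rw [Function.iterate_succ_apply, this, iterate_diff_zero]
  have hcomp : ∀ i, deltaComp i (deltaPow k : PDO U 𝕜).coeff l = if i = l - k then 1 else 0 := by
    intro i
    rw [deltaComp_eq_sum hd (R := (k - l + i).toNat + 1) (by push_cast; omega),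
      Finset.sum_range_succ', Finset.sum_eq_zero]
    · have e : l - i + ((0 : ℕ) : ℤ) = k ↔ i = l - k := by push_cast; omega
      simp only [deltaPow, e]
      split_ifs
      · simp; rfl
      · simp; rfl
    · intro r _
      simp only [deltaPow]
      split_ifs
      · rw [hdiff, shift_zero_fn, smul_zero]
      · rw [iterate_diff_zero, shift_zero_fn, smul_zero]
  rw [mul_coeff_eq_sum ha hd (s := insert (l - k) (Finset.Icc (l - k) a))
    (Finset.subset_insert _ _)]
  simp [hcomp]

theorem mul_deltaPow_deltaPow (A : PDO U 𝕜) (j k : ℤ) :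
    A * deltaPow j * deltaPow k = A * deltaPow (j + k) := by
  ext1
  funext l
  simp only [mul_deltaPow_coeff]
  congr 1
  ring

protected theorem mul_one (A : PDO U 𝕜) : A * 1 = A := by
  ext1
  funext l
  exact (mul_deltaPow_coeff A 0 l).trans (by rw [sub_zero])

theorem pow_succ' (A : PDO U 𝕜) (k : ℕ) : A ^ (k + 1) = A ^ k * A := rfl

/-- `(Z ∘ Δ ∘ Z⁻¹)^k ∘ Z = Z ∘ Δ^k`. -/
theorem dressed_pow_mul {Z Zinv : PDO U 𝕜} (h : Zinv * Z = 1) (k : ℕ) :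
    (Z * deltaPow 1 * Zinv) ^ k * Z = Z * deltaPow k := by
  induction k with
  | zero => exact (deltaPow_zero_mul Z).trans (PDO.mul_one Z).symm
  | succ k ih =>
    rw [pow_succ', PDO.mul_assoc, PDO.mul_assoc (Z * deltaPow 1), h, PDO.mul_one, ← PDO.mul_assoc,
      ih, mul_deltaPow_deltaPow]
    push_cast
    rfl

theorem coeff_mul_eq_add (A Z : PDO U 𝕜) (l : ℤ) :
    (A * Z).coeff l = (A.geOne * Z).coeff l + (A.leZero * Z).coeff l := by
  obtain ⟨a, ha⟩ := A.bdd
  obtain ⟨z, hz⟩ := Z.bdd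
  rw [mul_coeff_eq_sum ha hz subset_rfl,
    mul_coeff_eq_sum (a := a) (fun i hi => by simp [geOne, ha i hi]) hz subset_rfl,
    mul_coeff_eq_sum (a := a) (fun i hi => by simp [leZero, ha i hi]) hz subset_rfl,
    ← Finset.sum_add_distrib]
  refine Finset.sum_congr rfl fun i _ => ?_
  rw [← add_mul]
  congr 1
  simp only [geOne, leZero]
  by_cases h : 1 ≤ i
  · simp [h, show ¬ i ≤ 0 by omega]
  · simp [h, show i ≤ 0 by omega]

theorem deltaPow_nat_mul_coeff (j : ℕ) (Z : PDO U 𝕜) :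
    deltaComp j Z.coeff =
      (fun (X : ℤ → DFun U 𝕜) (l : ℤ) => shift 1 (X (l - 1)) + diff (X l))^[j] Z.coeff := by
  obtain ⟨z, hz⟩ := Z.bdd
  induction j with
  | zero => exact deltaComp_zero hz
  | succ j ih =>
    rw [Function.iterate_succ_apply', ← ih]
    funext l
    push_cast
    exact deltaComp_add_one hz _ _

/-- The operator `A_{≥1} ∘ Z` in terms of the operators `Δ^j ∘ Z`, `j ≥ 1`. -/
theorem geOne_mul_coeff (A Z : PDO U 𝕜) : ∃ N : ℕ, ∀ l, (A.geOne * Z).coeff l =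
    ∑ j ∈ Finset.range N, A.coeff (j + 1 : ℕ) *
      (fun (X : ℤ → DFun U 𝕜) (l : ℤ) => shift 1 (X (l - 1)) + diff (X l))^[j + 1] Z.coeff l := by
  obtain ⟨a, ha⟩ := A.bdd
  obtain ⟨z, hz⟩ := Z.bdd
  refine ⟨a.toNat, fun l => ?_⟩
  rw [mul_coeff_eq_sum (a := a) (fun i hi => by simp [geOne, ha i hi]) hz
    (s := Finset.Icc (min (l - z) 0) a) (Finset.Icc_subset_Icc (min_le_left _ _) le_rfl)]
  simp only [← deltaPow_nat_mul_coeff]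
  symm
  refine Finset.sum_bij_ne_zero (fun j _ _ => ((j + 1 : ℕ) : ℤ)) ?_ ?_ ?_ ?_
  · intro j hj _
    simp only [Finset.mem_range] at hj
    simp only [Finset.mem_Icc]
    push_cast
    omega
  · intro j _ _ j' _ _ h
    simpa using h
  · intro i hi h
    have h1 : 1 ≤ i := by
      by_contra h1
      simp [geOne, h1] at h
    simp only [Finset.mem_Icc] at hi
    -- The sum over `j < N` runs over the exponents `i = j + 1 ≥ 1`; other exponents do not
    -- contribute to `A_{≥1}`.
    refine ⟨(i - 1).toNat, by simp; omega, ?_, by push_cast; omega⟩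
    have e : (((i - 1).toNat + 1 : ℕ) : ℤ) = i := by push_cast; omega
    rw [e]
    simpa [geOne, h1] using h
  · intro j _ _
    have : (1 : ℤ) ≤ ((j + 1 : ℕ) : ℤ) := by push_cast; omega
    simp only [geOne, this, if_true]

end PDO

end Operators

/-! ### The algebra of smooth functions and its commuting derivations -/

section Smooth

variable {U : Set Times} {𝕜 : Type*} [RCLike 𝕜]

theorem ext₀_of_mem (f : U → 𝕜) {t : Times} (ht : t ∈ U) : ext₀ f t = f ⟨t, ht⟩ :=
  Subtype.val_injective.extend_apply f 0 ⟨t, ht⟩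

theorem ext₀_coe (f : U → 𝕜) (t : U) : ext₀ f t = f t := ext₀_of_mem f t.2

theorem ext₀_of_notMem (f : U → 𝕜) {t : Times} (ht : t ∉ U) : ext₀ f t = 0 :=
  Function.extend_apply' _ _ t fun ⟨a, ha⟩ => ht (ha ▸ a.2)

theorem ext₀_add (f g : U → 𝕜) (t : Times) : ext₀ (f + g) t = ext₀ f t + ext₀ g t := by
  by_cases ht : t ∈ U
  · simp [ext₀_of_mem _ ht]
  · simp [ext₀_of_notMem _ ht]

theorem ext₀_mul (f g : U → 𝕜) (t : Times) : ext₀ (f * g) t = ext₀ f t * ext₀ g t := by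
  by_cases ht : t ∈ U
  · simp [ext₀_of_mem _ ht]
  · simp [ext₀_of_notMem _ ht]

theorem ext₀_smul (c : ℝ) (f : U → 𝕜) (t : Times) : ext₀ (c • f) t = c • ext₀ f t := by
  by_cases ht : t ∈ U
  · simp [ext₀_of_mem _ ht]
  · simp [ext₀_of_notMem _ ht]

theorem SmoothFn.add {f g : DFun U 𝕜} (hf : SmoothFn f) (hg : SmoothFn g) : SmoothFn (f + g) :=
  fun n t ht S => ((hf n t ht S).add (hg n t ht S)).congr fun _ _ => ext₀_add _ _ _

theorem SmoothFn.mul {f g : DFun U 𝕜} (hf : SmoothFn f) (hg : SmoothFn g) : SmoothFn (f * g) :=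
  fun n t ht S => ((hf n t ht S).mul (hg n t ht S)).congr fun _ _ => ext₀_mul _ _ _

theorem smoothFn_algebraMap (c : ℝ) : SmoothFn (algebraMap ℝ (DFun U 𝕜) c) :=
  fun _ _ _ _ => (contDiffOn_const (c := algebraMap ℝ 𝕜 c)).congr fun _ hx => ext₀_of_mem _ hx

theorem SmoothFn.inv {f : DFun U 𝕜} (hf : SmoothFn f) (h0 : ∀ n t, f n t ≠ 0) :
    SmoothFn f⁻¹ := fun n t ht S =>
  ((hf n t ht S).inv fun x hx => by rw [ext₀_of_mem _ hx]; exact h0 _ _).congr fun x hx => by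
    have hx' : Function.updateFinset t S x ∈ U := hx
    simp [ext₀_of_mem _ hx']

theorem SmoothFn.shift {f : DFun U 𝕜} (hf : SmoothFn f) (m : ℤ) : SmoothFn (shift m f) :=
  fun n => hf (n + m)

theorem update_updateFinset_of_mem (t : Times) {S : Finset ℕ+} (x : S → ℝ) {k : ℕ+} (hk : k ∈ S)
    (y : ℝ) : Function.update (Function.updateFinset t S x) k y =
      Function.updateFinset t S (Function.update x ⟨k, hk⟩ y) := by
  funext j
  by_cases hj : j = k
  · subst hj
    simp [Function.updateFinset, hk]
  · by_cases hS : j ∈ S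
    · simp [Function.updateFinset, hS, Function.update_of_ne, hj]
    · simp [Function.updateFinset, hS, hj]

theorem updateFinset_restrict (t : Times) (S : Finset ℕ+) :
    Function.updateFinset t S (fun j => t j) = t := by
  funext j
  simp [Function.updateFinset]

theorem SmoothFn.hasDerivAt_section (hU : IsTimeDomain U) {f : DFun U 𝕜} (hf : SmoothFn f) (n : ℤ)
    {t : Times} (ht : t ∈ U) {S : Finset ℕ+} {k : ℕ+} (hk : k ∈ S) {x : S → ℝ}
    (hx : Function.updateFinset t S x ∈ U) :
    HasDerivAt (fun y => ext₀ (f n) (Function.update (Function.updateFinset t S x) k y))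
      (fderiv ℝ (fun x : S → ℝ => ext₀ (f n) (Function.updateFinset t S x)) x
        (Pi.single ⟨k, hk⟩ 1)) (Function.updateFinset t S x k) := by
  simp only [update_updateFinset_of_mem t x hk]
  have h1 : HasFDerivAt (fun x : S → ℝ => ext₀ (f n) (Function.updateFinset t S x))
      (fderiv ℝ (fun x : S → ℝ => ext₀ (f n) (Function.updateFinset t S x)) x) x :=
    (((hf n t ht S).contDiffAt ((hU t ht S).mem_nhds hx)).differentiableAt (by simp)).hasFDerivAt
  have h2 : Function.updateFinset t S x k = x ⟨k, hk⟩ := by simp [Function.updateFinset, hk]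
  rw [h2]
  have h3 := hasDerivAt_update x ⟨k, hk⟩ (x ⟨k, hk⟩)
  have h4 : HasFDerivAt (fun x : S → ℝ => ext₀ (f n) (Function.updateFinset t S x))
      (fderiv ℝ (fun x : S → ℝ => ext₀ (f n) (Function.updateFinset t S x)) x)
      (Function.update x ⟨k, hk⟩ (x ⟨k, hk⟩)) := by rwa [Function.update_eq_self]
  exact h4.comp_hasDerivAt _ h3

/-- Expresses `∂/∂t_k`, defined by a one-variable derivative, through the Fréchet derivative of a
finite section, where smoothness and symmetry of second derivatives are available. -/
theorem SmoothFn.pd_section (hU : IsTimeDomain U) {f : DFun U 𝕜} (hf : SmoothFn f) (n : ℤ)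
    {t : Times} (ht : t ∈ U) {S : Finset ℕ+} {k : ℕ+} (hk : k ∈ S) {x : S → ℝ}
    (hx : Function.updateFinset t S x ∈ U) :
    ext₀ (pd k f n) (Function.updateFinset t S x) =
      fderiv ℝ (fun x : S → ℝ => ext₀ (f n) (Function.updateFinset t S x)) x
        (Pi.single ⟨k, hk⟩ 1) := by
  rw [ext₀_of_mem _ hx]
  exact (hf.hasDerivAt_section hU n ht hk hx).deriv

theorem SmoothFn.hasDerivAt_pd (hU : IsTimeDomain U) {f : DFun U 𝕜} (hf : SmoothFn f) (k : ℕ+)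
    (n : ℤ) (t : U) :
    HasDerivAt (fun y => ext₀ (f n) (Function.update (t : Times) k y)) (pd k f n t)
      ((t : Times) k) := by
  have e := updateFinset_restrict (t : Times) {k}
  have h := hf.hasDerivAt_section hU n t.2 (Finset.mem_singleton_self k)
    (x := fun j => (t : Times) j) (by rw [e]; exact t.2)
  rw [e] at h
  exact h.differentiableAt.hasDerivAt

theorem SmoothFn.pd_add (hU : IsTimeDomain U) {f g : DFun U 𝕜} (hf : SmoothFn f) (hg : SmoothFn g)
    (k : ℕ+) : pd k (f + g) = pd k f + pd k g := by
  funext n t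
  refine (((hf.hasDerivAt_pd hU k n t).add (hg.hasDerivAt_pd hU k n t)).congr_of_eventuallyEq
    (Filter.Eventually.of_forall fun y => ?_)).deriv
  exact ext₀_add _ _ _

theorem SmoothFn.pd_smul (hU : IsTimeDomain U) {f : DFun U 𝕜} (hf : SmoothFn f) (c : ℝ)
    (k : ℕ+) : pd k (c • f) = c • pd k f := by
  funext n t
  refine (((hf.hasDerivAt_pd hU k n t).const_smul c).congr_of_eventuallyEq
    (Filter.Eventually.of_forall fun y => ?_)).deriv
  exact ext₀_smul _ _ _

theorem SmoothFn.pd_mul (hU : IsTimeDomain U) {f g : DFun U 𝕜} (hf : SmoothFn f) (hg : SmoothFn g)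
    (k : ℕ+) : pd k (f * g) = f * pd k g + g * pd k f := by
  funext n t
  have h := ((hf.hasDerivAt_pd hU k n t).mul (hg.hasDerivAt_pd hU k n t)).congr_of_eventuallyEq
    (f₁ := fun y => ext₀ ((f * g) n) (Function.update (t : Times) k y))
    (Filter.Eventually.of_forall fun y => ext₀_mul _ _ _)
  refine h.deriv.trans ?_
  simp only [Function.update_eq_self, ext₀_coe, Pi.add_apply, Pi.mul_apply]
  ring

theorem SmoothFn.contDiffOn_pd_section (hU : IsTimeDomain U) {f : DFun U 𝕜} (hf : SmoothFn f)
    (n : ℤ) {t : Times} (ht : t ∈ U) {S : Finset ℕ+} {k : ℕ+} (hk : k ∈ S) :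
    ContDiffOn ℝ ((⊤ : ℕ∞) : WithTop ℕ∞)
      (fun x : S → ℝ => ext₀ (pd k f n) (Function.updateFinset t S x))
      {x : S → ℝ | Function.updateFinset t S x ∈ U} :=
  (((hf n t ht S).fderiv_of_isOpen (hU t ht S) (m := ((⊤ : ℕ∞) : WithTop ℕ∞))
    (by simp)).clm_apply contDiffOn_const).congr fun _ hx => hf.pd_section hU n ht hk hx

theorem SmoothFn.pd (hU : IsTimeDomain U) {f : DFun U 𝕜} (hf : SmoothFn f) (k : ℕ+) :
    SmoothFn (pd k f) := by
  intro n t ht S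
  -- The time `t_k` need not be among those in `S`: the derivative is handled on the larger section
  -- and then restricted along the affine map `φ`.
  have h := hf.contDiffOn_pd_section hU n ht (Finset.mem_insert_self k S)
  set φ : (S → ℝ) → (↥(insert k S) → ℝ) :=
    fun x j => Function.updateFinset t S x j with hφ
  have hφ' : ∀ x, Function.updateFinset t (insert k S) (φ x) = Function.updateFinset t S x := by
    intro x
    funext j
    by_cases hj : j ∈ insert k S
    · rw [Function.updateFinset, dif_pos hj]
    · rw [Function.updateFinset, dif_neg hj, Function.updateFinset, dif_neg]
      exact fun h' => hj (Finset.mem_insert_of_mem h')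
  have hsm : ContDiff ℝ ((⊤ : ℕ∞) : WithTop ℕ∞) φ := by
    refine contDiff_pi.2 fun j => ?_
    by_cases hj : (j : ℕ+) ∈ S
    · simp only [hφ, Function.updateFinset, dif_pos hj]
      exact contDiff_apply ℝ ℝ _
    · simp only [hφ, Function.updateFinset, dif_neg hj]
      exact contDiff_const
  refine (h.comp (s := {x : S → ℝ | Function.updateFinset t S x ∈ U}) hsm.contDiffOn
    fun x hx => ?_).congr fun x _ => ?_
  · simpa [hφ'] using hx
  · simp [hφ']

theorem SmoothFn.pd_comm (hU : IsTimeDomain U) {f : DFun U 𝕜} (hf : SmoothFn f) (j k : ℕ+) :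
    DMKP.pd j (DMKP.pd k f) = DMKP.pd k (DMKP.pd j f) := by
  funext n t
  have hj : j ∈ ({j, k} : Finset ℕ+) := by simp
  have hk : k ∈ ({j, k} : Finset ℕ+) := by simp
  set S : Finset ℕ+ := {j, k}
  set x : S → ℝ := fun i => (t : Times) i
  have e : Function.updateFinset (t : Times) S x = t := updateFinset_restrict _ S
  have hx : Function.updateFinset (t : Times) S x ∈ U := by rw [e]; exact t.2
  have hnhds := (hU t t.2 S).mem_nhds hx
  have htwo : (2 : WithTop ℕ∞) ≤ ((⊤ : ℕ∞) : WithTop ℕ∞) :=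
    WithTop.coe_le_coe.2 (le_top : (2 : ℕ∞) ≤ ⊤)
  have hdiff : DifferentiableAt ℝ
      (fderiv ℝ fun x : S → ℝ => ext₀ (f n) (Function.updateFinset t S x)) x :=
    (((hf n t t.2 S).contDiffAt hnhds).fderiv_right (m := 1)
      (one_add_one_eq_two.trans_le htwo)).differentiableAt one_ne_zero
  have key : ∀ (a b : ℕ+) (ha : a ∈ S) (hb : b ∈ S), DMKP.pd a (DMKP.pd b f) n t =
      fderiv ℝ (fderiv ℝ fun x : S → ℝ => ext₀ (f n) (Function.updateFinset t S x)) x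
        (Pi.single ⟨a, ha⟩ 1) (Pi.single ⟨b, hb⟩ 1) := by
    intro a b ha hb
    have h1 := (hf.pd hU b).pd_section hU n t.2 ha hx
    rw [e, ext₀_coe] at h1
    have h2 : (fun x : S → ℝ => ext₀ (DMKP.pd b f n) (Function.updateFinset t S x)) =ᶠ[nhds x]
        fun x => fderiv ℝ (fun x : S → ℝ => ext₀ (f n) (Function.updateFinset t S x)) x
          (Pi.single ⟨b, hb⟩ 1) :=
      Filter.eventuallyEq_of_mem hnhds fun y hy => hf.pd_section hU n t.2 hb hy
    rw [h1, h2.fderiv_eq, fderiv_clm_apply hdiff (differentiableAt_const _)]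
    simp
  rw [key j k hj hk, key k j hk hj]
  -- Both mixed derivatives are values of the second Fréchet derivative of one section, which is
  -- symmetric.
  refine (((hf n t t.2 S).contDiffAt hnhds).isSymmSndFDerivAt ?_) _ _
  simp only [minSmoothness_of_isRCLikeNormedField]
  exact htwo

variable (U 𝕜) in
/-- The algebra of smooth functions of `(n, t)`. -/
def smoothFunctions : Subalgebra ℝ (DFun U 𝕜) where
  carrier := {f | SmoothFn f}
  mul_mem' := SmoothFn.mul
  add_mem' := SmoothFn.add
  algebraMap_mem' := smoothFn_algebraMap

variable (𝕜) in
/-- The derivation `∂/∂t_k` of the algebra of smooth functions. -/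
def pdDerivation (hU : IsTimeDomain U) (k : ℕ+) :
    Derivation ℝ (smoothFunctions U 𝕜) (smoothFunctions U 𝕜) :=
  Derivation.mk'
    { toFun := fun f => ⟨pd k f, SmoothFn.pd hU f.2 k⟩
      map_add' := fun f g => Subtype.ext (SmoothFn.pd_add hU f.2 g.2 k)
      map_smul' := fun c f => Subtype.ext (SmoothFn.pd_smul hU f.2 c k) }
    fun f g => Subtype.ext (SmoothFn.pd_mul hU f.2 g.2 k)

theorem pdDerivation_comm (hU : IsTimeDomain U) (j k : ℕ+) (f : smoothFunctions U 𝕜) :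
    pdDerivation 𝕜 hU j (pdDerivation 𝕜 hU k f) = pdDerivation 𝕜 hU k (pdDerivation 𝕜 hU j f) :=
  Subtype.ext (SmoothFn.pd_comm hU f.2 j k)

theorem isUnit_smoothFunctions {f : smoothFunctions U 𝕜} (h : ∀ n t, (f : DFun U 𝕜) n t ≠ 0) :
    IsUnit f :=
  IsUnit.of_mul_eq_one ⟨(f : DFun U 𝕜)⁻¹, SmoothFn.inv f.2 h⟩ <| Subtype.ext <| by
    funext n t
    exact mul_inv_cancel₀ (h n t)

/-- The shift `n ↦ n + 1` on smooth functions. -/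
def shiftHom : smoothFunctions U 𝕜 →+* smoothFunctions U 𝕜 where
  toFun f := ⟨shift 1 f, SmoothFn.shift f.2 1⟩
  map_one' := rfl
  map_mul' _ _ := rfl
  map_zero' := rfl
  map_add' _ _ := rfl

theorem pdDerivation_shiftHom (hU : IsTimeDomain U) (k : ℕ+) (f : smoothFunctions U 𝕜) :
    pdDerivation 𝕜 hU k (shiftHom f) = shiftHom (pdDerivation 𝕜 hU k f) := rfl

end Smooth

/-! ### The linear problem for the shifted wave function -/

section LinearProblem

variable {R : Type*} [CommRing R]

/-- The coefficients of `Δ ∘ X`, where the shift operator acts on coefficients by `γ`. -/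
def deltaMul (γ : R →+* R) (X : ℤ → R) (l : ℤ) : R := γ (X (l - 1)) + (γ (X l) - X l)

theorem deltaMul_add (γ : R →+* R) (X Y : ℤ → R) :
    deltaMul γ (X + Y) = deltaMul γ X + deltaMul γ Y := by
  funext l
  simp only [deltaMul, Pi.add_apply, map_add]
  ring

theorem deltaMul_zero (γ : R →+* R) : deltaMul γ (0 : ℤ → R) = 0 := by
  funext l
  simp [deltaMul]

theorem deltaMul_smul (γ : R →+* R) (b : R) (X : ℤ → R) :
    deltaMul γ (b • X) = γ b • deltaMul γ X + (γ b - b) • X := by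
  funext l
  simp only [deltaMul, Pi.add_apply, Pi.smul_apply, smul_eq_mul, map_mul]
  ring

theorem iterate_deltaMul_eq_zero (γ : R →+* R) {Z : ℤ → R} (hZ : ∀ l, 0 < l → Z l = 0) (j : ℕ)
    (l : ℤ) (hl : (j : ℤ) < l) : (deltaMul γ)^[j] Z l = 0 := by
  induction j generalizing l with
  | zero => exact hZ l hl
  | succ j ih =>
    push_cast at hl
    rw [Function.iterate_succ_apply', deltaMul, ih _ (by omega), ih _ (by omega)]
    simp

theorem iterate_deltaMul_leading (γ : R →+* R) {Z : ℤ → R} (hZ : ∀ l, 0 < l → Z l = 0) (j : ℕ) :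
    (deltaMul γ)^[j] Z j = γ^[j] (Z 0) := by
  induction j with
  | zero => rfl
  | succ j ih =>
    rw [Function.iterate_succ_apply', deltaMul,
      iterate_deltaMul_eq_zero γ hZ j ((j + 1 : ℕ) : ℤ) (by push_cast; omega), Function.iterate_succ_apply', ← ih]
    push_cast
    simp

theorem isUnit_iterate_deltaMul_leading (γ : R →+* R) {Z : ℤ → R} (hZ : ∀ l, 0 < l → Z l = 0)
    (hu : IsUnit (Z 0)) (j : ℕ) : IsUnit ((deltaMul γ)^[j] Z j) := by
  rw [iterate_deltaMul_leading γ hZ]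
  induction j with
  | zero => exact hu
  | succ j ih =>
    rw [Function.iterate_succ_apply']
    exact ih.map γ

/-- If a combination of series with invertible leading coefficients in a subring has coefficients
in that subring, then so do its weights. -/
theorem mem_of_triangular_sum_mem {A : Type*} [CommRing A] (φ : R →+* A) (Y : ℕ → ℤ → R)
    (hY : ∀ (j : ℕ) (l : ℤ), (j : ℤ) < l → Y j l = 0) (hu : ∀ j : ℕ, IsUnit (Y j j)) (N : ℕ)
    (b : ℕ → A) (h : ∀ l, ∃ r, ∑ j ∈ Finset.range N, b j * φ (Y j l) = φ r) :
    ∀ j < N, ∃ r, b j = φ r := by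
  induction N with
  | zero => intro j hj; exact absurd hj (Nat.not_lt_zero j)
  | succ N ih =>
    -- The coefficient at `l = N` involves only the last series, whose leading coefficient is
    -- invertible.
    obtain ⟨c, hc⟩ : ∃ r, b N = φ r := by
      obtain ⟨r, hr⟩ := h N
      rw [Finset.sum_range_succ, Finset.sum_eq_zero, zero_add] at hr
      · obtain ⟨v, hv⟩ := (hu N).exists_right_inv
        refine ⟨r * v, ?_⟩
        rw [map_mul, ← hr, mul_assoc, ← map_mul, hv, map_one, mul_one]
      · intro j hj
        rw [hY j N (by exact_mod_cast Finset.mem_range.1 hj), map_zero, mul_zero]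
    intro j hj
    rcases Nat.lt_succ_iff_lt_or_eq.1 hj with hj | rfl
    · refine ih (fun l => ?_) j hj
      obtain ⟨r, hr⟩ := h l
      refine ⟨r - c * Y N l, ?_⟩
      rw [Finset.sum_range_succ] at hr
      rw [map_sub, ← hr, map_mul, hc, add_sub_cancel_right]
    · exact ⟨c, hc⟩

/-- The leading coefficients are units in distinct degrees, so a combination of degree at most `1`
loses its weights one after another from the top, except the one at `Y 1`. -/
theorem eq_smul_of_triangular_sum (Y : ℕ → ℤ → R)
    (hY : ∀ (j : ℕ) (l : ℤ), (j : ℤ) < l → Y j l = 0) (hu : ∀ j : ℕ, IsUnit (Y j j)) (N : ℕ)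
    (b : ℕ → R) (h : ∀ l : ℤ, 1 < l → ∑ j ∈ Finset.range N, b j * Y (j + 1) l = 0) :
    ∃ c, ∀ l, ∑ j ∈ Finset.range N, b j * Y (j + 1) l = c * Y 1 l := by
  induction N with
  | zero => exact ⟨0, by simp⟩
  | succ N ih =>
    rcases N.eq_zero_or_pos with rfl | hN
    · exact ⟨b 0, by simp⟩
    · have hb : b N = 0 := by
        have h1 := h (N + 1 : ℕ) (by push_cast; omega)
        rw [Finset.sum_range_succ, Finset.sum_eq_zero, zero_add] at h1
        · exact (hu (N + 1)).mul_left_eq_zero.1 h1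
        · intro j hj
          have := Finset.mem_range.1 hj
          rw [hY _ _ (by push_cast; omega), mul_zero]
      simp only [Finset.sum_range_succ, hb, zero_mul, add_zero] at h ⊢
      exact ih h

variable [Algebra ℝ R] (δ : ℕ+ → Derivation ℝ R R)

/-- The action of `∂ₖ + λ^k` on Laurent series in `λ⁻¹`. -/
def twistedDeriv (k : ℕ+) (X : ℤ → R) (l : ℤ) : R := δ k (X l) + X (l - k)

variable {δ} {γ : R →+* R} {Z : ℤ → R}

theorem twistedDeriv_add (k : ℕ+) (X Y : ℤ → R) :
    twistedDeriv δ k (X + Y) = twistedDeriv δ k X + twistedDeriv δ k Y := by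
  funext l
  simp only [twistedDeriv, Pi.add_apply, map_add]
  ring

theorem twistedDeriv_smul (k : ℕ+) (b : R) (X : ℤ → R) :
    twistedDeriv δ k (b • X) = δ k b • X + b • twistedDeriv δ k X := by
  funext l
  simp only [twistedDeriv, Pi.add_apply, Pi.smul_apply, smul_eq_mul, Derivation.leibniz]
  ring

theorem twistedDeriv_deltaMul (hγ : ∀ k f, δ k (γ f) = γ (δ k f)) (k : ℕ+) (X : ℤ → R) :
    twistedDeriv δ k (deltaMul γ X) = deltaMul γ (twistedDeriv δ k X) := by
  funext l
  simp only [twistedDeriv, deltaMul, map_add, map_sub, hγ, sub_right_comm l 1]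
  ring

/-- The span of the `Δ^j ∘ Z` with `j ≥ 1`. -/
def positiveSpan (γ : R →+* R) (Z : ℤ → R) : Submodule R (ℤ → R) :=
  Submodule.span R (Set.range fun j : ℕ => (deltaMul γ)^[j + 1] Z)

theorem mem_positiveSpan_of_eq_sum {X : ℤ → R} (N : ℕ) (r : ℕ → R)
    (h : ∀ l, X l = ∑ j ∈ Finset.range N, r j * (deltaMul γ)^[j + 1] Z l) :
    X ∈ positiveSpan γ Z := by
  have hX : X = ∑ j ∈ Finset.range N, r j • (deltaMul γ)^[j + 1] Z := by
    funext l
    rw [h, Finset.sum_apply]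
    rfl
  rw [hX]
  exact Submodule.sum_mem _ fun j _ => Submodule.smul_mem _ _ (Submodule.subset_span ⟨j, rfl⟩)

theorem deltaMul_mem_positiveSpan {X : ℤ → R} (hX : X ∈ positiveSpan γ Z) :
    deltaMul γ X ∈ positiveSpan γ Z := by
  induction hX using Submodule.span_induction with
  | mem X hX =>
    obtain ⟨j, rfl⟩ := hX
    simp only [← Function.iterate_succ_apply']
    exact Submodule.subset_span ⟨j + 1, rfl⟩
  | zero => rw [deltaMul_zero]; exact zero_mem _
  | add X Y _ _ hX hY => rw [deltaMul_add]; exact add_mem hX hY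
  | smul b X hX ih =>
    rw [deltaMul_smul]
    exact add_mem (Submodule.smul_mem _ _ ih) (Submodule.smul_mem _ _ hX)

/-- The operator `∂_k + λ^k` commutes with `Δ` and is a derivation over the coefficients, so its
effect on the span is determined by its value at `Z`. -/
theorem twistedDeriv_mem_positiveSpan (hγ : ∀ k f, δ k (γ f) = γ (δ k f)) (k : ℕ+)
    (hZ : twistedDeriv δ k Z ∈ positiveSpan γ Z) {X : ℤ → R} (hX : X ∈ positiveSpan γ Z) :
    twistedDeriv δ k X ∈ positiveSpan γ Z := by
  induction hX using Submodule.span_induction with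
  | mem X hX =>
    obtain ⟨j, rfl⟩ := hX
    simp only
    have : ∀ j : ℕ, twistedDeriv δ k ((deltaMul γ)^[j] Z) ∈ positiveSpan γ Z := by
      intro j
      induction j with
      | zero => exact hZ
      | succ j ih =>
        rw [Function.iterate_succ_apply', twistedDeriv_deltaMul hγ]
        exact deltaMul_mem_positiveSpan ih
    exact this _
  | zero =>
    have : twistedDeriv δ k (0 : ℤ → R) = 0 := by funext l; simp [twistedDeriv]
    rw [this]
    exact zero_mem _
  | add X Y _ _ hX hY => rw [twistedDeriv_add]; exact add_mem hX hY
  | smul b X hX ih =>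
    rw [twistedDeriv_smul]
    exact add_mem (Submodule.smul_mem _ _ hX) (Submodule.smul_mem _ _ ih)

/-- The coefficient of `s^m` in `w(n, t - [s], λ)`, up to the exponential factor. -/
def waveShift (D : ℕ → R → R) (Z : ℤ → R) : ℕ → ℤ → R
  | 0 => Z
  | m + 1 => fun l => D (m + 1) (Z l) - D m (Z (l - 1))

/-- Coefficient form of `s ∂_s w(t - [s]) = -∑ s^k ∂_k w(t - [s])`; after removal of `e^ξ`, `∂_k`
becomes `∂_k + λ^k`. The two terms of each `waveShift` come from the factor `1 - sλ`, and the
contributions of `λ^k` telescope. -/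
theorem succ_smul_waveShift {D : ℕ → R → R} (hD0 : ∀ f, D 0 f = f)
    (hD : ∀ m f, ((m + 1 : ℕ) : ℝ) • D (m + 1) f =
      -∑ k ∈ Finset.range (m + 1), δ k.succPNat (D (m - k) f)) (Z : ℤ → R) (m : ℕ) :
    ((m + 1 : ℕ) : ℝ) • waveShift D Z (m + 1) =
      -∑ k ∈ Finset.range (m + 1), twistedDeriv δ k.succPNat (waveShift D Z (m - k)) := by
  funext l
  have h1 : ∀ k ∈ Finset.range m, twistedDeriv δ k.succPNat (waveShift D Z (m - k)) l =
      δ k.succPNat (D (m - k) (Z l)) - δ k.succPNat (D (m - 1 - k) (Z (l - 1))) +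
        (D (m - k) (Z (l - k - 1)) - D (m - (k + 1)) (Z (l - (k + 1 : ℕ) - 1))) := by
    intro k hk
    obtain ⟨r, rfl⟩ := Nat.exists_eq_add_of_lt (Finset.mem_range.1 hk)
    rw [show k + r + 1 - k = r + 1 by omega, show k + r + 1 - 1 - k = r by omega,
      show k + r + 1 - (k + 1) = r by omega]
    simp only [twistedDeriv, waveShift, Nat.succPNat_coe, map_sub]
    push_cast
    rw [show l - ((k : ℤ) + 1) = l - k - 1 by ring]
  have h2 : twistedDeriv δ m.succPNat (waveShift D Z (m - m)) l =
      δ m.succPNat (D (m - m) (Z l)) + D (m - m) (Z (l - m - 1)) := by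
    simp only [Nat.sub_self, waveShift, twistedDeriv, hD0, Nat.succPNat_coe]
    push_cast
    rw [show l - ((m : ℤ) + 1) = l - m - 1 by ring]
  have h3 : ∑ k ∈ Finset.range m, δ k.succPNat (D (m - 1 - k) (Z (l - 1))) =
      -((m : ℝ) • D m (Z (l - 1))) := by
    cases m with
    | zero => simp
    | succ m => rw [hD, neg_neg]; rfl
  simp only [Pi.smul_apply, Pi.neg_apply, Finset.sum_apply]
  rw [Finset.sum_range_succ, Finset.sum_congr rfl h1, h2, Finset.sum_add_distrib,
    Finset.sum_sub_distrib, h3, Finset.sum_range_sub' (fun k => D (m - k) (Z (l - k - 1)))]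
  have h4 := hD m (Z l)
  rw [Finset.sum_range_succ] at h4
  simp only [waveShift, smul_sub, h4, Nat.sub_zero, Nat.cast_zero, sub_zero]
  push_cast
  rw [add_smul, one_smul]
  ring

theorem waveShift_mem_positiveSpan {D : ℕ → R → R} (hD0 : ∀ f, D 0 f = f)
    (hD : ∀ m f, ((m + 1 : ℕ) : ℝ) • D (m + 1) f =
      -∑ k ∈ Finset.range (m + 1), δ k.succPNat (D (m - k) f))
    (hγ : ∀ k f, δ k (γ f) = γ (δ k f)) (hZ : ∀ k, twistedDeriv δ k Z ∈ positiveSpan γ Z)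
    (m : ℕ) : waveShift D Z (m + 1) ∈ positiveSpan γ Z := by
  induction m using Nat.strong_induction_on with
  | _ m ih =>
    have hm : ((m + 1 : ℕ) : ℝ) ≠ 0 := Nat.cast_ne_zero.2 m.succ_ne_zero
    have h : ((m + 1 : ℕ) : ℝ) • waveShift D Z (m + 1) ∈ positiveSpan γ Z := by
      rw [succ_smul_waveShift hD0 hD]
      refine neg_mem (Submodule.sum_mem _ fun k hk => ?_)
      obtain ⟨r, rfl⟩ := Nat.exists_eq_add_of_le (Nat.lt_succ_iff.1 (Finset.mem_range.1 hk))
      rw [Nat.add_sub_cancel_left]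
      -- The summand `k = m` involves `waveShift D Z 0 = Z` and is covered by the hypothesis on `Z`,
      -- the others by induction.
      cases r with
      | zero => exact hZ _
      | succ r => exact twistedDeriv_mem_positiveSpan hγ _ (hZ _) (ih r (by omega))
    have hinv := Submodule.smul_mem _ (algebraMap ℝ R ((m + 1 : ℕ) : ℝ)⁻¹) h
    rwa [algebraMap_smul, smul_smul, inv_mul_cancel₀ hm, one_smul] at hinv

/-- The linear problem `w(n, t) - w(n, t - [s]) ∈ span (Δ w)`, coefficientwise. -/
theorem exists_linear_problem {D : ℕ → R → R} (hD0 : ∀ f, D 0 f = f) (hDz : ∀ m, D m 0 = 0)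
    (hD : ∀ m f, ((m + 1 : ℕ) : ℝ) • D (m + 1) f =
      -∑ k ∈ Finset.range (m + 1), δ k.succPNat (D (m - k) f))
    (hγ : ∀ k f, δ k (γ f) = γ (δ k f)) (hZ : ∀ k, twistedDeriv δ k Z ∈ positiveSpan γ Z)
    (hord : ∀ l, 0 < l → Z l = 0) (hu : IsUnit (Z 0)) :
    ∃ E : ℕ → R, E 0 = 1 ∧ ∀ m j : ℕ,
      D m (Z (-((j + 1 : ℕ) : ℤ))) - D (m + 1) (Z (-(j : ℤ))) = D m (Z 0) * E (j + 1) := by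
  have hlead := isUnit_iterate_deltaMul_leading γ hord hu 1
  obtain ⟨v, hv⟩ := hlead.exists_right_inv
  refine ⟨fun j => v * deltaMul γ Z (1 - j), ?_, fun m j => ?_⟩
  · simpa [mul_comm] using hv
  have hmem := waveShift_mem_positiveSpan hD0 hD hγ hZ m
  obtain ⟨c, hc⟩ := Finsupp.mem_span_range_iff_exists_finsupp.1 hmem
  obtain ⟨N, hN⟩ := c.support.exists_nat_subset_range
  have hsum : ∀ l, waveShift D Z (m + 1) l =
      ∑ j ∈ Finset.range N, c j * (deltaMul γ)^[j + 1] Z l := by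
    intro l
    rw [← hc, Finsupp.sum_of_support_subset c hN _ (by simp)]
    simp
  obtain ⟨a, ha⟩ := eq_smul_of_triangular_sum (fun j => (deltaMul γ)^[j] Z)
    (iterate_deltaMul_eq_zero γ hord) (isUnit_iterate_deltaMul_leading γ hord hu) N c
    (fun l hl => by
      rw [← hsum]
      simp only [waveShift]
      rw [hord l (by omega), hord (l - 1) (by omega), hDz, hDz, sub_zero])
  -- The coefficient of `λ^1` determines the factor `a`, that of `λ^{-j}` is the claim.
  have h1 := (hsum 1).trans (ha 1)
  have h2 := (hsum (-j)).trans (ha (-j))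
  simp only [waveShift, Function.iterate_one] at h1 h2 hv
  rw [hord 1 one_pos, hDz, sub_self] at h1
  push_cast at h1 h2 hv ⊢
  rw [show -((j : ℤ) + 1) = -j - 1 by ring, show (1 : ℤ) - (j + 1) = -j by ring]
  linear_combination (-1 : R) * h2 + v * deltaMul γ Z (-j) * h1 + a * deltaMul γ Z (-j) * hv

end LinearProblem

/-! ### Formal shifts as exponentials of nilpotent derivations -/

section Taylor

variable {σ R : Type*} [CommRing R]

variable (σ R) in
/-- The ideal of power series of order at least `N`. -/
def orderIdeal (N : ℕ) : Ideal (MvPowerSeries σ R) where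
  carrier := {φ | ∀ d : σ →₀ ℕ, d.degree < N → MvPowerSeries.coeff d φ = 0}
  zero_mem' := fun _ _ => rfl
  add_mem' := fun hφ hψ d hd => by rw [map_add, hφ d hd, hψ d hd, add_zero]
  smul_mem' := fun c φ hφ d hd => by
    classical
    rw [smul_eq_mul, MvPowerSeries.coeff_mul]
    refine Finset.sum_eq_zero fun p hp => ?_
    have h := congrArg Finsupp.degree (Finset.HasAntidiagonal.mem_antidiagonal.1 hp)
    rw [map_add] at h
    rw [hφ p.2 (by omega), mul_zero]

theorem mem_orderIdeal {N : ℕ} {φ : MvPowerSeries σ R} :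
    φ ∈ orderIdeal σ R N ↔ ∀ d : σ →₀ ℕ, d.degree < N → MvPowerSeries.coeff d φ = 0 := Iff.rfl

/-- Power series in `σ` modulo those of order at least `N`. -/
abbrev TruncSeries (σ R : Type*) [CommRing R] (N : ℕ) : Type _ :=
  MvPowerSeries σ R ⧸ orderIdeal σ R N

/-- The truncation map. -/
abbrev truncMap (N : ℕ) : MvPowerSeries σ R →+* TruncSeries σ R N :=
  Ideal.Quotient.mk (orderIdeal σ R N)

theorem truncMap_eq_iff {N : ℕ} {φ ψ : MvPowerSeries σ R} : truncMap N φ = truncMap N ψ ↔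
    ∀ d : σ →₀ ℕ, d.degree < N → MvPowerSeries.coeff d φ = MvPowerSeries.coeff d ψ := by
  rw [Ideal.Quotient.eq, mem_orderIdeal]
  simp only [map_sub, sub_eq_zero]

theorem eq_of_truncMap_eq {φ ψ : MvPowerSeries σ R} (h : ∀ N, truncMap N φ = truncMap N ψ) :
    φ = ψ := by
  ext d
  exact truncMap_eq_iff.1 (h (d.degree + 1)) d (Nat.lt_succ_self _)

variable [Algebra ℝ R]

/-- Needed for the rational weights `1/m!` in `IsNilpotent.exp`; defined through `ℝ` so that they
agree with the real ones. -/
instance (N : ℕ) : Module ℚ (TruncSeries σ R N) := Module.compHom _ (algebraMap ℚ ℝ)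

/-- Power series with real coefficients as power series with coefficients in `R`. -/
abbrev realSeries : MvPowerSeries σ ℝ →+* MvPowerSeries σ R :=
  MvPowerSeries.map (algebraMap ℝ R)

variable (σ) in
/-- The action of a derivation on the coefficients of power series. -/
def coeffDeriv (D : Derivation ℝ R R) : MvPowerSeries σ R →ₗ[ℝ] MvPowerSeries σ R where
  toFun φ := fun d => D (φ d)
  map_add' _ _ := funext fun _ => D.map_add _ _
  map_smul' _ _ := funext fun _ => D.map_smul _ _

theorem coeff_coeffDeriv (D : Derivation ℝ R R) (φ : MvPowerSeries σ R) (d : σ →₀ ℕ) :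
    MvPowerSeries.coeff d (coeffDeriv σ D φ) = D (MvPowerSeries.coeff d φ) := rfl

theorem coeffDeriv_mul (D : Derivation ℝ R R) (φ ψ : MvPowerSeries σ R) :
    coeffDeriv σ D (φ * ψ) = φ * coeffDeriv σ D ψ + coeffDeriv σ D φ * ψ := by
  classical
  ext d
  rw [coeff_coeffDeriv, MvPowerSeries.coeff_mul, map_add, MvPowerSeries.coeff_mul,
    MvPowerSeries.coeff_mul, map_sum, ← Finset.sum_add_distrib]
  refine Finset.sum_congr rfl fun p _ => ?_
  simp only [coeff_coeffDeriv, Derivation.leibniz, smul_eq_mul]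
  ring

theorem coeffDeriv_realSeries (D : Derivation ℝ R R) (c : MvPowerSeries σ ℝ) :
    coeffDeriv σ D (realSeries c) = 0 := by
  ext d
  rw [coeff_coeffDeriv, MvPowerSeries.coeff_map, Derivation.map_algebraMap, map_zero]

theorem coeffDeriv_realSeries_mul (D : Derivation ℝ R R) (c : MvPowerSeries σ ℝ)
    (φ : MvPowerSeries σ R) :
    coeffDeriv σ D (realSeries c * φ) = realSeries c * coeffDeriv σ D φ := by
  rw [coeffDeriv_mul, coeffDeriv_realSeries, zero_mul, add_zero]

theorem coeffDeriv_C (D : Derivation ℝ R R) (f : R) :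
    coeffDeriv σ D (MvPowerSeries.C f) = MvPowerSeries.C (D f) := by
  classical
  ext d
  rw [coeff_coeffDeriv, MvPowerSeries.coeff_C, MvPowerSeries.coeff_C]
  split_ifs
  · rfl
  · exact map_zero _

variable (δ : ℕ+ → Derivation ℝ R R)

/-- The derivation `∑_{k ≤ N} y_k ∂_k` of power series with coefficients in `R`. -/
def flow (y : ℕ+ → MvPowerSeries σ ℝ) (N : ℕ) : MvPowerSeries σ R →ₗ[ℝ] MvPowerSeries σ R :=
  ∑ k ∈ Finset.range N,
    LinearMap.mulLeft ℝ (realSeries (y k.succPNat)) ∘ₗ coeffDeriv σ (δ k.succPNat)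

variable {δ} {y z : ℕ+ → MvPowerSeries σ ℝ} {N : ℕ}

theorem flow_apply (φ : MvPowerSeries σ R) : flow δ y N φ =
    ∑ k ∈ Finset.range N, realSeries (y k.succPNat) * coeffDeriv σ (δ k.succPNat) φ := by
  simp [flow]

theorem flow_mul (φ ψ : MvPowerSeries σ R) :
    flow δ y N (φ * ψ) = φ * flow δ y N ψ + flow δ y N φ * ψ := by
  simp only [flow_apply, coeffDeriv_mul, Finset.mul_sum, Finset.sum_mul, ← Finset.sum_add_distrib]
  exact Finset.sum_congr rfl fun k _ => by ring

theorem flow_realSeries_mul (c : MvPowerSeries σ ℝ) (φ : MvPowerSeries σ R) :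
    flow δ y N (realSeries c * φ) = realSeries c * flow δ y N φ := by
  simp only [flow_apply, coeffDeriv_realSeries_mul, Finset.mul_sum]
  exact Finset.sum_congr rfl fun k _ => by ring

theorem flow_realSeries (c : MvPowerSeries σ ℝ) : flow δ y N (realSeries c) = 0 := by
  simp only [flow_apply, coeffDeriv_realSeries, mul_zero, Finset.sum_const_zero]

theorem flow_add (φ : MvPowerSeries σ R) :
    flow δ (y + z) N φ = flow δ y N φ + flow δ z N φ := by
  simp only [flow_apply, Pi.add_apply, map_add, add_mul, Finset.sum_add_distrib]

theorem coeffDeriv_flow (hδ : ∀ j k f, δ j (δ k f) = δ k (δ j f)) (j : ℕ+)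
    (φ : MvPowerSeries σ R) :
    coeffDeriv σ (δ j) (flow δ y N φ) = flow δ y N (coeffDeriv σ (δ j) φ) := by
  simp only [flow_apply, map_sum, coeffDeriv_realSeries_mul]
  refine Finset.sum_congr rfl fun k _ => ?_
  congr 1
  ext d
  exact hδ _ _ _

theorem flow_comm (hδ : ∀ j k f, δ j (δ k f) = δ k (δ j f)) (φ : MvPowerSeries σ R) :
    flow δ y N (flow δ z N φ) = flow δ z N (flow δ y N φ) := by
  rw [flow_apply (y := y), flow_apply (y := y), map_sum]
  refine Finset.sum_congr rfl fun k _ => ?_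
  rw [flow_realSeries_mul, coeffDeriv_flow hδ]

/-- Displacements whose `k`-th component has order at least `k`. -/
def IsGraded (y : ℕ+ → MvPowerSeries σ ℝ) : Prop :=
  ∀ k : ℕ+, y k ∈ orderIdeal σ ℝ k

theorem IsGraded.add (hy : IsGraded y) (hz : IsGraded z) : IsGraded (y + z) :=
  fun k => add_mem (hy k) (hz k)

theorem IsGraded.neg (hy : IsGraded y) : IsGraded (-y) := fun k => neg_mem (hy k)

theorem isGraded_zero : IsGraded (0 : ℕ+ → MvPowerSeries σ ℝ) := fun _ => zero_mem _

theorem coeff_bracket [DecidableEq σ] (i : σ) (k : ℕ+) (d : σ →₀ ℕ) :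
    MvPowerSeries.coeff d (bracket i k) =
      if d = Finsupp.single i (k : ℕ) then 1 / ((k : ℕ) : ℝ) else 0 := by
  rw [bracket, MvPowerSeries.coeff_C_mul, MvPowerSeries.coeff_X_pow, mul_ite, mul_one, mul_zero]

theorem isGraded_bracket (i : σ) : IsGraded (bracket i) := by
  classical
  intro k d hd
  rw [coeff_bracket, if_neg]
  rintro rfl
  simp at hd

theorem mul_mem_orderIdeal {m n : ℕ} {φ ψ : MvPowerSeries σ R} (hφ : φ ∈ orderIdeal σ R m)
    (hψ : ψ ∈ orderIdeal σ R n) : φ * ψ ∈ orderIdeal σ R (m + n) := by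
  classical
  intro d hd
  rw [MvPowerSeries.coeff_mul]
  refine Finset.sum_eq_zero fun p hp => ?_
  have h := congrArg Finsupp.degree (Finset.HasAntidiagonal.mem_antidiagonal.1 hp)
  rw [map_add] at h
  rcases lt_or_ge p.1.degree m with h1 | h1
  · rw [hφ _ h1, zero_mul]
  · rw [hψ _ (by omega), mul_zero]

theorem orderIdeal_antitone {m n : ℕ} (h : m ≤ n) : orderIdeal σ R n ≤ orderIdeal σ R m :=
  fun _ hφ d hd => hφ d (hd.trans_le h)

/-- Each `y_k` has order at least `k ≥ 1`, while `∂_k` acts on coefficients only. This makes the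
flow nilpotent on truncated series. -/
theorem flow_mem_orderIdeal (hy : IsGraded y) {n : ℕ} {φ : MvPowerSeries σ R}
    (hφ : φ ∈ orderIdeal σ R n) : flow δ y N φ ∈ orderIdeal σ R (n + 1) := by
  rw [flow_apply]
  refine sum_mem fun k _ => ?_
  have h1 : realSeries (y k.succPNat) ∈ orderIdeal σ R (k.succPNat : ℕ) := fun d hd => by
    rw [MvPowerSeries.coeff_map, hy _ d hd, map_zero]
  have h2 : coeffDeriv σ (δ k.succPNat) φ ∈ orderIdeal σ R n := fun d hd => by
    rw [coeff_coeffDeriv, hφ d hd, map_zero]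
  refine orderIdeal_antitone ?_ (mul_mem_orderIdeal h1 h2)
  simp only [Nat.succPNat_coe]
  omega

theorem iterate_flow_mem_orderIdeal (hy : IsGraded y) (m : ℕ) (φ : MvPowerSeries σ R) :
    (flow δ y N)^[m] φ ∈ orderIdeal σ R m := by
  induction m with
  | zero => exact fun d hd => absurd hd (Nat.not_lt_zero _)
  | succ m ih =>
    rw [Function.iterate_succ_apply']
    exact flow_mem_orderIdeal hy ih

variable (δ) in
/-- The derivation `∑ y_k ∂_k` of truncated power series. -/
def truncFlow (hy : IsGraded y) (N : ℕ) : Module.End ℝ (TruncSeries σ R N) :=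
  (Submodule.Quotient.restrictScalarsEquiv ℝ (orderIdeal σ R N)).toLinearMap ∘ₗ
    ((orderIdeal σ R N).restrictScalars ℝ).mapQ ((orderIdeal σ R N).restrictScalars ℝ) (flow δ y N)
      (fun _ hφ => orderIdeal_antitone N.le_succ (flow_mem_orderIdeal hy hφ)) ∘ₗ
    (Submodule.Quotient.restrictScalarsEquiv ℝ (orderIdeal σ R N)).symm.toLinearMap

theorem truncFlow_truncMap (hy : IsGraded y) (φ : MvPowerSeries σ R) :
    truncFlow δ hy N (truncMap N φ) = truncMap N (flow δ y N φ) := rfl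

theorem truncFlow_mul (hy : IsGraded y) (u v : TruncSeries σ R N) :
    truncFlow δ hy N (u * v) = u * truncFlow δ hy N v + truncFlow δ hy N u * v := by
  obtain ⟨φ, rfl⟩ := Ideal.Quotient.mk_surjective u
  obtain ⟨ψ, rfl⟩ := Ideal.Quotient.mk_surjective v
  rw [← map_mul, truncFlow_truncMap, truncFlow_truncMap, truncFlow_truncMap, flow_mul, map_add,
    map_mul, map_mul]

theorem truncFlow_pow_truncMap (hy : IsGraded y) (m : ℕ) (φ : MvPowerSeries σ R) :
    (truncFlow δ hy N ^ m) (truncMap N φ) = truncMap N ((flow δ y N)^[m] φ) := by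
  induction m with
  | zero => rfl
  | succ m ih =>
    rw [pow_succ', Module.End.mul_apply, ih, truncFlow_truncMap, Function.iterate_succ_apply']

theorem truncFlow_pow_eq_zero (hy : IsGraded y) : truncFlow δ hy N ^ N = 0 := by
  refine LinearMap.ext fun u => ?_
  obtain ⟨φ, rfl⟩ := Ideal.Quotient.mk_surjective u
  rw [truncFlow_pow_truncMap, LinearMap.zero_apply, Ideal.Quotient.eq_zero_iff_mem]
  exact iterate_flow_mem_orderIdeal hy N φ

theorem isNilpotent_truncFlow (hy : IsGraded y) : IsNilpotent (truncFlow δ hy N) :=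
  ⟨N, truncFlow_pow_eq_zero hy⟩

theorem truncFlow_add (hy : IsGraded y) (hz : IsGraded z) :
    truncFlow δ (hy.add hz) N = truncFlow δ hy N + truncFlow δ hz N := by
  refine LinearMap.ext fun u => ?_
  obtain ⟨φ, rfl⟩ := Ideal.Quotient.mk_surjective u
  rw [LinearMap.add_apply, truncFlow_truncMap, truncFlow_truncMap, truncFlow_truncMap, flow_add,
    map_add]

theorem truncFlow_commute (hδ : ∀ j k f, δ j (δ k f) = δ k (δ j f)) (hy : IsGraded y)
    (hz : IsGraded z) : Commute (truncFlow δ hy N) (truncFlow δ hz N) := by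
  refine LinearMap.ext fun u => ?_
  obtain ⟨φ, rfl⟩ := Ideal.Quotient.mk_surjective u
  simp only [Module.End.mul_apply, truncFlow_truncMap, flow_comm hδ]

variable (δ) in
/-- The automorphism `f(t) ↦ f(t + y)` of truncated power series. -/
def truncShift (hy : IsGraded y) (N : ℕ) : Module.End ℝ (TruncSeries σ R N) :=
  IsNilpotent.exp (truncFlow δ hy N)

theorem truncShift_mul (hy : IsGraded y) (u v : TruncSeries σ R N) :
    truncShift δ hy N (u * v) = truncShift δ hy N u * truncShift δ hy N v :=
  Module.End.exp_mul_of_derivation ℝ _ _ (truncFlow_mul hy) (isNilpotent_truncFlow hy) u v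

/-- The flows commute because the `∂_k` do, hence the exponential of their sum is the product of the
exponentials. -/
theorem truncShift_add (hδ : ∀ j k f, δ j (δ k f) = δ k (δ j f)) (hy : IsGraded y)
    (hz : IsGraded z) (u : TruncSeries σ R N) :
    truncShift δ (hy.add hz) N u = truncShift δ hy N (truncShift δ hz N u) := by
  rw [truncShift, truncFlow_add hy hz, IsNilpotent.exp_add_of_commute (truncFlow_commute hδ hy hz)
    (isNilpotent_truncFlow hy) (isNilpotent_truncFlow hz)]
  rfl

theorem truncShift_apply (hy : IsGraded y) (u : TruncSeries σ R N) : truncShift δ hy N u =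
    ∑ m ∈ Finset.range N, ((m.factorial : ℝ)⁻¹) • (truncFlow δ hy N ^ m) u := by
  rw [truncShift, IsNilpotent.exp_eq_sum (truncFlow_pow_eq_zero hy), LinearMap.sum_apply]
  refine Finset.sum_congr rfl fun m _ => ?_
  have : ((m.factorial : ℝ)⁻¹) = algebraMap ℚ ℝ ((m.factorial : ℚ)⁻¹) := by simp
  rw [this]
  rfl

theorem truncShift_of_truncFlow_eq_zero (hy : IsGraded y) {u : TruncSeries σ R N}
    (hu : truncFlow δ hy N u = 0) : truncShift δ hy N u = u := by
  cases N with
  | zero =>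
    have : Subsingleton (TruncSeries σ R 0) := by
      refine ⟨fun a b => ?_⟩
      obtain ⟨φ, rfl⟩ := Ideal.Quotient.mk_surjective a
      obtain ⟨ψ, rfl⟩ := Ideal.Quotient.mk_surjective b
      exact truncMap_eq_iff.2 fun d hd => absurd hd (Nat.not_lt_zero _)
    exact Subsingleton.elim _ _
  | succ N =>
    rw [truncShift_apply, Finset.sum_range_succ', Finset.sum_eq_zero]
    · simp
    · intro m _
      rw [pow_succ, Module.End.mul_apply, hu, map_zero, smul_zero]

theorem truncShift_realSeries (hy : IsGraded y) (c : MvPowerSeries σ ℝ) :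
    truncShift δ hy N (truncMap N (realSeries c)) = truncMap N (realSeries c) :=
  truncShift_of_truncFlow_eq_zero hy (by rw [truncFlow_truncMap, flow_realSeries, map_zero])

theorem truncShift_X (hy : IsGraded y) (i : σ) :
    truncShift δ hy N (truncMap N (MvPowerSeries.X i)) = truncMap N (MvPowerSeries.X i) := by
  have := truncShift_realSeries (δ := δ) (N := N) hy (MvPowerSeries.X i)
  rwa [realSeries, MvPowerSeries.map_X] at this

theorem truncShift_one (hy : IsGraded y) : truncShift δ hy N 1 = 1 := by
  have := truncShift_realSeries (δ := δ) (N := N) hy 1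
  rwa [map_one, map_one] at this

end Taylor

/-! ### Taylor series and the coefficients of `f(t - [s])` -/

section TaylorSeries

variable {σ R : Type*} [CommRing R] [Algebra ℝ R]

/-- The formal Taylor expansion of `f(t + y)` in an algebra with derivations `∂ₖ`. -/
def taylorSeries (δ : ℕ+ → Derivation ℝ R R) (f : R) (y : ℕ+ → MvPowerSeries σ ℝ) :
    MvPowerSeries σ R :=
  fun d => ∑ᶠ l : List ℕ+, (((l.length.factorial : ℝ)⁻¹) * MvPowerSeries.coeff d (l.map y).prod) •
    l.foldr (fun k g => δ k g) f

/-- The map `(k, l) ↦ (k + 1) :: l`. -/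
def succConsEmbedding : ℕ × List ℕ+ ↪ List ℕ+ where
  toFun p := p.1.succPNat :: p.2
  inj' p q h := by
    simp only [List.cons.injEq] at h
    exact Prod.ext (Nat.succPNat_injective h.1) h.2

theorem succConsEmbedding_apply (k : ℕ) (l : List ℕ+) :
    succConsEmbedding (k, l) = k.succPNat :: l := rfl

/-- The lists of length `m` with entries at most `N`. -/
def boundedLists (N : ℕ) : ℕ → Finset (List ℕ+)
  | 0 => {[]}
  | m + 1 => (Finset.range N ×ˢ boundedLists N m).map succConsEmbedding

theorem mem_boundedLists {N m : ℕ} {l : List ℕ+} :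
    l ∈ boundedLists N m ↔ l.length = m ∧ ∀ k ∈ l, (k : ℕ) ≤ N := by
  induction m generalizing l with
  | zero =>
    simp only [boundedLists, Finset.mem_singleton, List.length_eq_zero_iff]
    constructor
    · rintro rfl; simp
    · exact fun h => h.1
  | succ m ih =>
    simp only [boundedLists, Finset.mem_map, Finset.mem_product, Finset.mem_range, ih,
      succConsEmbedding_apply, Prod.exists]
    constructor
    · rintro ⟨a, l, ⟨ha, hl⟩, rfl⟩
      refine ⟨by simp [hl.1], fun k hk => ?_⟩
      rcases List.mem_cons.1 hk with rfl | hk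
      · simpa using ha
      · exact hl.2 k hk
    · rintro ⟨h1, h2⟩
      cases l with
      | nil => simp at h1
      | cons k l =>
        refine ⟨k.natPred, l, ⟨?_, by simpa using h1, fun j hj => h2 j (by simp [hj])⟩, by simp⟩
        have h3 := h2 k (by simp)
        have h4 := k.natPred_add_one
        omega

variable {δ : ℕ+ → Derivation ℝ R R} {y : ℕ+ → MvPowerSeries σ ℝ} {N : ℕ}

theorem iterate_flow_C (f : R) (m : ℕ) :
    (flow δ y N)^[m] (MvPowerSeries.C f) = ∑ l ∈ boundedLists N m,
      realSeries (l.map y).prod * MvPowerSeries.C (l.foldr (fun k g => δ k g) f) := by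
  induction m with
  | zero => simp [boundedLists]
  | succ m ih =>
    rw [Function.iterate_succ_apply', ih, map_sum, boundedLists, Finset.sum_map,
      Finset.sum_product_right]
    refine Finset.sum_congr rfl fun l _ => ?_
    rw [flow_realSeries_mul, flow_apply, Finset.mul_sum]
    refine Finset.sum_congr rfl fun k _ => ?_
    simp only [coeffDeriv_C, succConsEmbedding_apply, List.map_cons, List.prod_cons,
      List.foldr_cons, map_mul]
    ring

theorem list_prod_mem_orderIdeal (hy : IsGraded y) (l : List ℕ+) :
    (l.map y).prod ∈ orderIdeal σ ℝ (l.map (fun k : ℕ+ => (k : ℕ))).sum := by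
  induction l with
  | nil => exact fun d hd => absurd hd (Nat.not_lt_zero _)
  | cons k l ih =>
    simp only [List.map_cons, List.prod_cons, List.sum_cons]
    exact mul_mem_orderIdeal (hy k) ih

theorem length_le_sum (l : List ℕ+) : l.length ≤ (l.map (fun k : ℕ+ => (k : ℕ))).sum := by
  induction l with
  | nil => simp
  | cons k l ih =>
    have := k.pos
    simp only [List.length_cons, List.map_cons, List.sum_cons]
    omega

theorem mem_le_sum (l : List ℕ+) : ∀ k ∈ l, (k : ℕ) ≤ (l.map (fun k : ℕ+ => (k : ℕ))).sum :=
  fun _ hk => List.single_le_sum (by simp) _ (List.mem_map_of_mem hk)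

/-- A list of times contributes in order at least the sum of its entries, so below degree `N` both
its length and its entries are bounded, and grouping by length gives the powers of the flow. -/
theorem coeff_taylorSeries (hy : IsGraded y) (f : R) {d : σ →₀ ℕ} (hd : d.degree < N) :
    MvPowerSeries.coeff d (taylorSeries δ f y) = ∑ m ∈ Finset.range N, ((m.factorial : ℝ)⁻¹) •
      MvPowerSeries.coeff d ((flow δ y N)^[m] (MvPowerSeries.C f)) := by
  classical
  have h1 : MvPowerSeries.coeff d (taylorSeries δ f y) =
      ∑ l ∈ (Finset.range N).biUnion (boundedLists N), (((l.length.factorial : ℝ)⁻¹) *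
        MvPowerSeries.coeff d (l.map y).prod) • l.foldr (fun k g => δ k g) f := by
    refine finsum_eq_sum_of_support_subset _ fun l hl => ?_
    have hs : (l.map (fun k : ℕ+ => (k : ℕ))).sum < N := by
      by_contra h
      refine hl ?_
      simp only
      rw [list_prod_mem_orderIdeal hy l d (by omega), mul_zero, zero_smul]
    simp only [Finset.coe_biUnion, Set.mem_iUnion, Finset.mem_coe, Finset.mem_range]
    refine ⟨l.length, (length_le_sum l).trans_lt hs, mem_boundedLists.2 ⟨rfl, fun k hk => ?_⟩⟩
    exact (mem_le_sum l k hk).trans hs.le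
  rw [h1, Finset.sum_biUnion]
  · refine Finset.sum_congr rfl fun m _ => ?_
    rw [iterate_flow_C, map_sum, Finset.smul_sum]
    refine Finset.sum_congr rfl fun l hl => ?_
    rw [(mem_boundedLists.1 hl).1, mul_comm (realSeries _), MvPowerSeries.coeff_C_mul,
      MvPowerSeries.coeff_map, mul_smul, mul_comm, ← Algebra.smul_def]
  · intro a _ b _ hab
    rw [Function.onFun, Finset.disjoint_left]
    intro l hl hl'
    exact hab ((mem_boundedLists.1 hl).1.symm.trans (mem_boundedLists.1 hl').1)

theorem truncShift_C (hy : IsGraded y) (f : R) :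
    truncShift δ hy N (truncMap N (MvPowerSeries.C f)) = truncMap N (taylorSeries δ f y) := by
  have h : truncShift δ hy N (truncMap N (MvPowerSeries.C f)) =
      truncMap N (∑ m ∈ Finset.range N, ((m.factorial : ℝ)⁻¹) •
        (flow δ y N)^[m] (MvPowerSeries.C f)) := by
    rw [truncShift_apply, map_sum]
    refine Finset.sum_congr rfl fun m _ => ?_
    rw [truncFlow_pow_truncMap]
    rfl
  rw [h, truncMap_eq_iff]
  intro d hd
  rw [coeff_taylorSeries hy f hd, map_sum]
  rfl

theorem taylorSeries_mul (hy : IsGraded y) (f g : R) :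
    taylorSeries δ (f * g) y = taylorSeries δ f y * taylorSeries δ g y := by
  refine eq_of_truncMap_eq fun N => ?_
  rw [map_mul, ← truncShift_C hy, ← truncShift_C hy, ← truncShift_C hy, ← truncShift_mul, ← map_mul,
    ← map_mul]

theorem taylorSeries_zero (y : ℕ+ → MvPowerSeries σ ℝ) : taylorSeries δ (0 : R) y = 0 := by
  ext d
  refine finsum_eq_zero_of_forall_eq_zero fun l => ?_
  have : l.foldr (fun k g => δ k g) (0 : R) = 0 := by
    induction l with
    | nil => rfl
    | cons k l ih => rw [List.foldr_cons, ih, map_zero]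
  rw [this, smul_zero]

theorem coeff_zero_taylorSeries (hy : IsGraded y) (f : R) :
    MvPowerSeries.coeff 0 (taylorSeries δ f y) = f := by
  rw [coeff_taylorSeries hy f (N := 1) (by simp)]
  simp

section Euler

variable (σ R) in
/-- The Euler operator `∑ s_i ∂/∂s_i`. -/
def euler : MvPowerSeries σ R →ₗ[ℝ] MvPowerSeries σ R where
  toFun φ := fun d => (d.degree : ℝ) • φ d
  map_add' _ _ := funext fun _ => smul_add _ _ _
  map_smul' _ _ := funext fun _ => smul_comm _ _ _

theorem coeff_euler (φ : MvPowerSeries σ R) (d : σ →₀ ℕ) :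
    MvPowerSeries.coeff d (euler σ R φ) = (d.degree : ℝ) • MvPowerSeries.coeff d φ := rfl

theorem euler_realSeries_mul (c : MvPowerSeries σ ℝ) (φ : MvPowerSeries σ R) :
    euler σ R (realSeries c * φ) = realSeries (euler σ ℝ c) * φ + realSeries c * euler σ R φ := by
  classical
  ext d
  rw [coeff_euler, MvPowerSeries.coeff_mul, map_add, MvPowerSeries.coeff_mul,
    MvPowerSeries.coeff_mul, Finset.smul_sum, ← Finset.sum_add_distrib]
  refine Finset.sum_congr rfl fun p hp => ?_
  rw [← Finset.HasAntidiagonal.mem_antidiagonal.1 hp]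
  simp only [coeff_euler, MvPowerSeries.coeff_map, map_add, Nat.cast_add, smul_eq_mul, map_mul,
    Algebra.smul_def]
  ring

theorem coeffDeriv_euler (D : Derivation ℝ R R) (φ : MvPowerSeries σ R) :
    coeffDeriv σ D (euler σ R φ) = euler σ R (coeffDeriv σ D φ) := by
  ext d
  rw [coeff_coeffDeriv, coeff_euler, coeff_euler, coeff_coeffDeriv, Derivation.map_smul]

theorem euler_flow (φ : MvPowerSeries σ R) : euler σ R (flow δ y N φ) =
    flow δ (fun k => euler σ ℝ (y k)) N φ + flow δ y N (euler σ R φ) := by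
  simp only [flow_apply, map_sum, euler_realSeries_mul, coeffDeriv_euler, Finset.sum_add_distrib]

/-- The chain rule for a power of the flow: the derivative of one factor can be moved to the front
since flows commute. -/
theorem euler_iterate_flow_C (hδ : ∀ j k f, δ j (δ k f) = δ k (δ j f)) (f : R) (m : ℕ) :
    euler σ R ((flow δ y N)^[m + 1] (MvPowerSeries.C f)) = ((m + 1 : ℕ) : ℝ) •
      flow δ (fun k => euler σ ℝ (y k)) N ((flow δ y N)^[m] (MvPowerSeries.C f)) := by
  induction m with
  | zero =>
    have : euler σ R (MvPowerSeries.C f) = 0 := by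
      classical
      ext d
      rw [coeff_euler, MvPowerSeries.coeff_C]
      split_ifs with h
      · subst h; simp
      · simp
    simp [euler_flow, this]
  | succ m ih =>
    rw [Function.iterate_succ_apply', euler_flow, ih, map_smul, flow_comm hδ,
      ← Function.iterate_succ_apply' (flow δ y N)]
    simp only [Nat.succ_eq_add_one]
    push_cast
    module

end Euler

variable (δ) in
/-- The coefficient of `s^m` in `f(t - [s])`. -/
def negShiftCoeff (m : ℕ) (f : R) : R := PowerSeries.coeff m (taylorSeries δ f (-bracket ()))

theorem negShiftCoeff_zero (f : R) : negShiftCoeff δ 0 f = f := by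
  rw [negShiftCoeff, PowerSeries.coeff, Finsupp.single_zero]
  exact coeff_zero_taylorSeries (isGraded_bracket ()).neg f

theorem negShiftCoeff_map_zero (m : ℕ) : negShiftCoeff δ m (0 : R) = 0 := by
  rw [negShiftCoeff, taylorSeries_zero, map_zero]

theorem euler_neg_bracket (k : ℕ+) :
    euler Unit ℝ ((-bracket ()) k) = -(MvPowerSeries.X () : MvPowerSeries Unit ℝ) ^ (k : ℕ) := by
  classical
  refine MvPowerSeries.ext fun d => ?_
  rw [coeff_euler, Pi.neg_apply, map_neg, map_neg, coeff_bracket, MvPowerSeries.coeff_X_pow]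
  split_ifs with h
  · subst h
    have : ((k : ℕ) : ℝ) ≠ 0 := Nat.cast_ne_zero.2 k.ne_zero
    simp [this]
  · simp

/-- Apply `s ∂_s` to `exp(-∑ s^k/k ∂_k) f`; it turns `-s^k/k` into `-s^k`. -/
theorem succ_smul_negShiftCoeff (hδ : ∀ j k f, δ j (δ k f) = δ k (δ j f)) (m : ℕ) (f : R) :
    ((m + 1 : ℕ) : ℝ) • negShiftCoeff δ (m + 1) f =
      -∑ k ∈ Finset.range (m + 1), δ k.succPNat (negShiftCoeff δ (m - k) f) := by
  have hy : IsGraded (-bracket ()) := (isGraded_bracket ()).neg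
  have hc : ∀ n, n < m + 3 → negShiftCoeff δ n f = ∑ p ∈ Finset.range (m + 3),
      ((p.factorial : ℝ)⁻¹) •
        PowerSeries.coeff n ((flow δ (-bracket ()) (m + 3))^[p] (MvPowerSeries.C f)) :=
    fun n hn => coeff_taylorSeries hy f (by simpa using hn)
  -- On the right only degrees up to `m` occur, so there the power `m + 2` of the flow drops out and
  -- both sides have the same number of exponential terms.
  have hvan : ∀ n, n < m + 2 →
      PowerSeries.coeff n ((flow δ (-bracket ()) (m + 3))^[m + 2] (MvPowerSeries.C f)) = 0 :=
    fun n hn => iterate_flow_mem_orderIdeal hy (m + 2) _ _ (by simpa using hn)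
  have hdeg : ∀ φ : MvPowerSeries Unit R, ((m + 1 : ℕ) : ℝ) • PowerSeries.coeff (m + 1) φ =
      PowerSeries.coeff (m + 1) (euler Unit R φ) := by
    intro φ
    rw [PowerSeries.coeff, coeff_euler]
    simp
  have hflow : ∀ φ : MvPowerSeries Unit R, PowerSeries.coeff (m + 1)
      (flow δ (fun k => euler Unit ℝ ((-bracket ()) k)) (m + 3) φ) =
      -∑ k ∈ Finset.range (m + 1), δ k.succPNat (PowerSeries.coeff (m - k) φ) := by
    intro φ
    have hk : ∀ k, PowerSeries.coeff (m + 1) (realSeries (euler Unit ℝ ((-bracket ()) k.succPNat)) *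
        coeffDeriv Unit (δ k.succPNat) φ) = if k + 1 ≤ m + 1 then
          -δ k.succPNat (PowerSeries.coeff (m - k) φ) else 0 := by
      intro k
      rw [euler_neg_bracket, map_neg, map_pow, realSeries, MvPowerSeries.map_X, Nat.succPNat_coe,
        neg_mul, map_neg]
      have := PowerSeries.coeff_X_pow_mul' (coeffDeriv Unit (δ k.succPNat) φ) (k + 1) (m + 1)
      rw [PowerSeries.X] at this
      rw [this, Nat.add_sub_add_right]
      split_ifs
      · rfl
      · rw [neg_zero]
    rw [flow_apply, map_sum]
    simp only [hk]
    rw [← Finset.sum_filter, ← Finset.sum_neg_distrib]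
    refine Finset.sum_congr ?_ fun _ _ => rfl
    ext k
    simp only [Finset.mem_filter, Finset.mem_range]
    omega
  have hlast : ∀ k ∈ Finset.range (m + 1), negShiftCoeff δ (m - k) f =
      ∑ p ∈ Finset.range (m + 2), ((p.factorial : ℝ)⁻¹) •
        PowerSeries.coeff (m - k) ((flow δ (-bracket ()) (m + 3))^[p] (MvPowerSeries.C f)) := by
    intro k _
    rw [hc _ (by omega), Finset.sum_range_succ, hvan _ (by omega), smul_zero, add_zero]
  rw [hc _ (by omega), Finset.smul_sum, Finset.sum_range_succ']
  have h0 : PowerSeries.coeff (m + 1)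
      ((flow δ (-bracket ()) (m + 3))^[0] (MvPowerSeries.C f)) = 0 :=
    PowerSeries.coeff_C_of_ne_zero (Nat.succ_ne_zero m)
  rw [h0, smul_zero, smul_zero, add_zero,
    Finset.sum_congr rfl fun k hk => congrArg (δ k.succPNat) (hlast k hk)]
  simp only [map_sum, Derivation.map_smul]
  rw [Finset.sum_comm, ← Finset.sum_neg_distrib]
  refine Finset.sum_congr rfl fun p _ => ?_
  rw [smul_comm, hdeg, euler_iterate_flow_C hδ, ← Finset.smul_sum, ← smul_neg, ← hflow]
  have hp : ((p + 1 : ℕ) : ℝ) ≠ 0 := Nat.cast_ne_zero.2 p.succ_ne_zero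
  have hsm : ∀ (c : ℝ) (φ : MvPowerSeries Unit R),
      PowerSeries.coeff (m + 1) (c • φ) = c • PowerSeries.coeff (m + 1) φ := fun _ _ => rfl
  rw [hsm, smul_smul, Nat.factorial_succ, Nat.cast_mul, mul_inv, mul_comm _ ((p + 1 : ℕ) : ℝ),
    mul_inv_cancel_left₀ hp]

theorem list_prod_neg_bracket (i : σ) (l : List ℕ+) :
    (l.map (-bracket i)).prod =
      MvPowerSeries.C ((l.map fun k : ℕ+ => -(1 / ((k : ℕ) : ℝ))).prod) *
        MvPowerSeries.X i ^ (l.map (fun k : ℕ+ => (k : ℕ))).sum := by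
  induction l with
  | nil => simp
  | cons k l ih =>
    simp only [List.map_cons, List.prod_cons, List.sum_cons, ih, Pi.neg_apply, bracket, map_mul,
      map_neg, pow_add]
    ring

/-- Only powers of the single variable `s_i` occur, so the coefficients are those of the
one-variable expansion. -/
theorem coeff_taylorSeries_neg_bracket [DecidableEq σ] (i : σ) (f : R) (d : σ →₀ ℕ) :
    MvPowerSeries.coeff d (taylorSeries δ f (-bracket i)) =
      if d = Finsupp.single i (d i) then negShiftCoeff δ (d i) f else 0 := by
  split_ifs with h
  · refine finsum_congr fun l => ?_
    congr 2
    rw [list_prod_neg_bracket, list_prod_neg_bracket, MvPowerSeries.coeff_C_mul,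
      MvPowerSeries.coeff_C_mul, MvPowerSeries.coeff_X_pow, MvPowerSeries.coeff_X_pow]
    congr 1
    have h1 : d = Finsupp.single i (l.map (fun k : ℕ+ => (k : ℕ))).sum ↔
        d i = (l.map (fun k : ℕ+ => (k : ℕ))).sum := by
      constructor
      · intro h'
        rw [h', Finsupp.single_eq_same]
      · intro h'
        rw [← h', ← h]
    have h2 : Finsupp.single () (d i) =
        Finsupp.single () (l.map (fun k : ℕ+ => (k : ℕ))).sum ↔
        d i = (l.map (fun k : ℕ+ => (k : ℕ))).sum := (Finsupp.single_injective ()).eq_iff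
    simp only [h1, h2]
  · refine finsum_eq_zero_of_forall_eq_zero fun l => ?_
    rw [list_prod_neg_bracket, MvPowerSeries.coeff_C_mul, MvPowerSeries.coeff_X_pow, if_neg]
    · rw [mul_zero, mul_zero, zero_smul]
    · intro h'
      apply h
      rw [h', Finsupp.single_eq_same]

theorem truncMap_X_pow_eq_zero (i : σ) :
    truncMap N (MvPowerSeries.X i : MvPowerSeries σ R) ^ N = 0 := by
  classical
  rw [← map_pow, Ideal.Quotient.eq_zero_iff_mem]
  intro d hd
  rw [MvPowerSeries.coeff_X_pow, if_neg]
  rintro rfl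
  simp at hd

theorem truncMap_taylorSeries_neg_bracket (i : σ) (f : R) :
    truncMap N (taylorSeries δ f (-bracket i)) = ∑ b ∈ Finset.range N,
      truncMap N (MvPowerSeries.X i) ^ b * truncMap N (MvPowerSeries.C (negShiftCoeff δ b f)) := by
  classical
  simp only [← map_pow, ← map_mul, ← map_sum]
  rw [truncMap_eq_iff]
  intro d hd
  rw [coeff_taylorSeries_neg_bracket, map_sum]
  have h : ∀ b, MvPowerSeries.coeff d (MvPowerSeries.X i ^ b *
      MvPowerSeries.C (negShiftCoeff δ b f)) =
      if d = Finsupp.single i b then negShiftCoeff δ b f else 0 := by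
    intro b
    rw [mul_comm, MvPowerSeries.coeff_C_mul, MvPowerSeries.coeff_X_pow, mul_ite, mul_one, mul_zero]
  simp only [h]
  split_ifs with h1
  · rw [Finset.sum_eq_single_of_mem (d i), if_pos h1]
    · rw [Finset.mem_range]
      exact (Finsupp.le_degree i d).trans_lt hd
    · intro b _ hb
      rw [if_neg]
      rintro rfl
      simp at hb
  · symm
    refine Finset.sum_eq_zero fun b _ => if_neg ?_
    rintro rfl
    simp at h1

end TaylorSeries

/-! ### Three-term identities and the elimination -/

section Fay

variable {σ R : Type*} [CommRing R] [Algebra ℝ R] {δ : ℕ+ → Derivation ℝ R R}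

/-- The linear problem, specialized to `λ⁻¹ = s`, determines `τ₁(t - [s]) / τ₁(t)`. -/
theorem negShiftCoeff_eq_mul {z E : ℕ → R} {τ₀ τ₁ : R} (h₀ : IsUnit τ₀) (hE0 : E 0 = 1)
    (hE : ∀ m j : ℕ, negShiftCoeff δ m (z (j + 1)) - negShiftCoeff δ (m + 1) (z j) =
      negShiftCoeff δ m (z 0) * E (j + 1))
    (hz : ∀ j, τ₁ * z j = negShiftCoeff δ j τ₀) (j : ℕ) :
    negShiftCoeff δ j τ₁ = τ₁ * E j := by
  have hy : IsGraded (-bracket ()) := (isGraded_bracket ()).neg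
  set G : R → PowerSeries R := fun f => taylorSeries δ f (-bracket ()) with hG
  have hGc : ∀ n f, PowerSeries.coeff n (G f) = negShiftCoeff δ n f := fun _ _ => rfl
  have hGmul : ∀ f g, G (f * g) = G f * G g := taylorSeries_mul hy
  have h1 : PowerSeries.mk z = G (z 0) * PowerSeries.mk E := by
    ext n
    rw [PowerSeries.coeff_mk, mul_comm, PowerSeries.coeff_mul,
      Finset.Nat.sum_antidiagonal_eq_sum_range_succ_mk, Finset.sum_range_succ']
    simp only [PowerSeries.coeff_mk, hGc, hE0, one_mul, Nat.sub_zero]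
    -- Setting `λ⁻¹ = s` sums the linear problem over `m + j = n - 1`, where the left-hand side
    -- telescopes.
    have h2 : ∀ k ∈ Finset.range n, E (k + 1) * negShiftCoeff δ (n - (k + 1)) (z 0) =
        negShiftCoeff δ (n - (k + 1)) (z (k + 1)) - negShiftCoeff δ (n - k) (z k) := by
      intro k hk
      obtain ⟨r, rfl⟩ := Nat.exists_eq_add_of_lt (Finset.mem_range.1 hk)
      rw [show k + r + 1 - (k + 1) = r by omega, show k + r + 1 - k = r + 1 by omega, mul_comm, hE]
    rw [Finset.sum_congr rfl h2, Finset.sum_range_sub (fun k => negShiftCoeff δ (n - k) (z k)),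
      Nat.sub_self, negShiftCoeff_zero, Nat.sub_zero, sub_add_cancel]
  have h3 : PowerSeries.C τ₁ * PowerSeries.mk z = G τ₀ := by
    ext n
    rw [PowerSeries.coeff_C_mul, PowerSeries.coeff_mk, hz, hGc]
  -- This is `z₀ = τ₀ / τ₁`, shifted by `-[s]`.
  have h4 : G τ₀ = G τ₁ * G (z 0) := by rw [← hGmul, hz, negShiftCoeff_zero]
  have h5 : IsUnit (G τ₀) := by
    rw [PowerSeries.isUnit_iff_constantCoeff, ← PowerSeries.coeff_zero_eq_constantCoeff_apply, hGc,
      negShiftCoeff_zero]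
    exact h₀
  have h6 : G τ₀ * G τ₁ = G τ₀ * (PowerSeries.C τ₁ * PowerSeries.mk E) := by
    calc G τ₀ * G τ₁ = PowerSeries.C τ₁ * (G τ₁ * PowerSeries.mk z) := by rw [← h3]; ring
      _ = PowerSeries.C τ₁ * ((G τ₁ * G (z 0)) * PowerSeries.mk E) := by rw [h1]; ring
      _ = G τ₀ * (PowerSeries.C τ₁ * PowerSeries.mk E) := by rw [← h4]; ring
  have h7 := congrArg (PowerSeries.coeff j) (h5.mul_left_cancel h6)
  rwa [PowerSeries.coeff_C_mul, PowerSeries.coeff_mk, hGc] at h7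

/-- The linear problem as an identity of truncated double series. -/
theorem truncated_linear_problem {Q : Type*} [CommRing Q] (c : R →+* Q) {D : ℕ → R → R}
    (hD0 : ∀ f, D 0 f = f) {z E : ℕ → R} (hE0 : E 0 = 1)
    (hE : ∀ m j : ℕ, D m (z (j + 1)) - D (m + 1) (z j) = D m (z 0) * E (j + 1))
    {N : ℕ} {x y : Q} (hx : x ^ N = 0) (hy : y ^ N = 0) :
    x * ∑ a ∈ Finset.range N, x ^ a * c (z a) -
        (x - y) * ∑ a ∈ Finset.range N, x ^ a * ∑ b ∈ Finset.range N, y ^ b * c (D b (z a)) =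
      y * (∑ b ∈ Finset.range N, y ^ b * c (D b (z 0))) *
        ∑ a ∈ Finset.range N, x ^ a * c (E a) := by
  -- Index shift in `y`: the top term vanishes because `y ^ N = 0`, and the term `b = 0` is left
  -- over. In `key2` this leftover is the unshifted series.
  have hyshift : ∀ g : ℕ → Q, y * ∑ b ∈ Finset.range N, y ^ b * g (b + 1) =
      ∑ b ∈ Finset.range N, y ^ b * g b - (if N = 0 then 0 else g 0) := by
    intro g
    cases N with
    | zero => simp
    | succ N =>
      rw [Finset.sum_range_succ' (fun b => y ^ b * g b), Finset.sum_range_succ, mul_add,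
        Finset.mul_sum, if_neg N.succ_ne_zero, ← mul_assoc y, ← pow_succ', hy]
      simp only [pow_zero, one_mul, zero_mul, add_zero, add_sub_cancel_right]
      exact Finset.sum_congr rfl fun b _ => by ring
  have key : ∑ a ∈ Finset.range N, x ^ a * ∑ b ∈ Finset.range N,
        y ^ b * (c (D b (z a)) - c (D b (z 0)) * c (E a)) =
      x * ∑ a ∈ Finset.range N, x ^ a * ∑ b ∈ Finset.range N, y ^ b * c (D (b + 1) (z a)) := by
    cases N with
    | zero => simp
    | succ N =>
      have hxshift : ∀ g : ℕ → Q, x * ∑ a ∈ Finset.range (N + 1), x ^ a * g a =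
          ∑ a ∈ Finset.range N, x ^ (a + 1) * g a := by
        intro g
        rw [Finset.sum_range_succ, mul_add, ← mul_assoc x, ← pow_succ', hx, zero_mul, add_zero,
          Finset.mul_sum]
        exact Finset.sum_congr rfl fun a _ => by ring
      rw [hxshift, Finset.sum_range_succ', hE0]
      simp only [map_one, mul_one, sub_self, mul_zero, Finset.sum_const_zero, add_zero]
      refine Finset.sum_congr rfl fun a _ => ?_
      congr 1
      refine Finset.sum_congr rfl fun b _ => ?_
      rw [← map_mul, ← map_sub, ← hE, sub_sub_cancel]
  have key2 : y * ∑ a ∈ Finset.range N, x ^ a * ∑ b ∈ Finset.range N, y ^ b * c (D (b + 1) (z a)) =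
      ∑ a ∈ Finset.range N, x ^ a * ∑ b ∈ Finset.range N, y ^ b * c (D b (z a)) -
        ∑ a ∈ Finset.range N, x ^ a * c (z a) := by
    rw [Finset.mul_sum, ← Finset.sum_sub_distrib]
    refine Finset.sum_congr rfl fun a ha => ?_
    have hN : N ≠ 0 := fun h => by simp [h] at ha
    rw [mul_left_comm, hyshift (fun b => c (D b (z a))), if_neg hN, hD0, mul_sub]
  have key3 : ∑ a ∈ Finset.range N, x ^ a * ∑ b ∈ Finset.range N,
        y ^ b * (c (D b (z a)) - c (D b (z 0)) * c (E a)) =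
      ∑ a ∈ Finset.range N, x ^ a * ∑ b ∈ Finset.range N, y ^ b * c (D b (z a)) -
        (∑ b ∈ Finset.range N, y ^ b * c (D b (z 0))) *
          ∑ a ∈ Finset.range N, x ^ a * c (E a) := by
    rw [Finset.mul_sum, ← Finset.sum_sub_distrib]
    refine Finset.sum_congr rfl fun a _ => ?_
    rw [mul_left_comm, ← mul_sub, Finset.sum_mul, ← Finset.sum_sub_distrib]
    congr 1
    exact Finset.sum_congr rfl fun b _ => by ring
  linear_combination (-y) * key3 + y * key + x * key2

/-- The three-term bilinear identity for shifts by `[s_i]` and `[s_j]` from any formal base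
point. -/
theorem three_term_identity (hδ : ∀ j k f, δ j (δ k f) = δ k (δ j f)) {z E : ℕ → R} {τ₀ τ₁ : R}
    (h₀ : IsUnit τ₀) (hE0 : E 0 = 1)
    (hE : ∀ m j : ℕ, negShiftCoeff δ m (z (j + 1)) - negShiftCoeff δ (m + 1) (z j) =
      negShiftCoeff δ m (z 0) * E (j + 1))
    (hz : ∀ j, τ₁ * z j = negShiftCoeff δ j τ₀) (i j : σ) {B : ℕ+ → MvPowerSeries σ ℝ}
    (hB : IsGraded B) :
    (MvPowerSeries.X i - MvPowerSeries.X j) * taylorSeries δ τ₀ B *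
        taylorSeries δ τ₁ (B + bracket i + bracket j) =
      MvPowerSeries.X i * taylorSeries δ τ₀ (B + bracket j) * taylorSeries δ τ₁ (B + bracket i) -
      MvPowerSeries.X j * taylorSeries δ τ₀ (B + bracket i) *
        taylorSeries δ τ₁ (B + bracket j) := by
  refine eq_of_truncMap_eq fun N => ?_
  have hE1 := negShiftCoeff_eq_mul h₀ hE0 hE hz
  set x : TruncSeries σ R N := truncMap N (MvPowerSeries.X i)
  set y : TruncSeries σ R N := truncMap N (MvPowerSeries.X j)
  set c : R →+* TruncSeries σ R N := (truncMap N).comp MvPowerSeries.C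
  have hx : x ^ N = 0 := truncMap_X_pow_eq_zero i
  have hy : y ^ N = 0 := truncMap_X_pow_eq_zero j
  have hi : IsGraded (bracket i) := isGraded_bracket i
  have hj : IsGraded (bracket j) := isGraded_bracket j
  have hSmul : ∀ {w : ℕ+ → MvPowerSeries σ ℝ} (hw : IsGraded w) (u v : TruncSeries σ R N),
      truncShift δ hw N (u * v) = truncShift δ hw N u * truncShift δ hw N v :=
    fun hw => truncShift_mul hw
  have hSC : ∀ {w : ℕ+ → MvPowerSeries σ ℝ} (hw : IsGraded w) (f : R),
      truncShift δ hw N (c f) = truncMap N (taylorSeries δ f w) := fun hw => truncShift_C hw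
  have hSx : ∀ {w : ℕ+ → MvPowerSeries σ ℝ} (hw : IsGraded w), truncShift δ hw N x = x :=
    fun hw => truncShift_X hw i
  have hSy : ∀ {w : ℕ+ → MvPowerSeries σ ℝ} (hw : IsGraded w), truncShift δ hw N y = y :=
    fun hw => truncShift_X hw j
  have hSpow : ∀ {w : ℕ+ → MvPowerSeries σ ℝ} (hw : IsGraded w) (a : ℕ),
      truncShift δ hw N (x ^ a) = x ^ a := by
    intro w hw a
    induction a with
    | zero => rw [pow_zero]; exact truncShift_one hw
    | succ a ih => rw [pow_succ, hSmul, ih, hSx]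
  have hSi : ∀ f, truncShift δ hi.neg N (c f) =
      ∑ a ∈ Finset.range N, x ^ a * c (negShiftCoeff δ a f) := fun f => by
    rw [hSC, truncMap_taylorSeries_neg_bracket]
    rfl
  have hSj : ∀ f, truncShift δ hj.neg N (c f) =
      ∑ b ∈ Finset.range N, y ^ b * c (negShiftCoeff δ b f) := fun f => by
    rw [hSC, truncMap_taylorSeries_neg_bracket]
    rfl
  have hW : c τ₁ * ∑ a ∈ Finset.range N, x ^ a * c (z a) = truncShift δ hi.neg N (c τ₀) := by
    rw [hSi, Finset.mul_sum]
    refine Finset.sum_congr rfl fun a _ => ?_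
    rw [mul_left_comm, ← map_mul, hz]
  have hEs : c τ₁ * ∑ a ∈ Finset.range N, x ^ a * c (E a) = truncShift δ hi.neg N (c τ₁) := by
    rw [hSi, Finset.mul_sum]
    refine Finset.sum_congr rfl fun a _ => ?_
    rw [mul_left_comm, ← map_mul, hE1]
  have hlin := truncated_linear_problem c negShiftCoeff_zero hE0 hE hx hy
  have hSW : truncShift δ hj.neg N (∑ a ∈ Finset.range N, x ^ a * c (z a)) =
      ∑ a ∈ Finset.range N, x ^ a *
        ∑ b ∈ Finset.range N, y ^ b * c (negShiftCoeff δ b (z a)) := by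
    rw [map_sum]
    refine Finset.sum_congr rfl fun a _ => ?_
    rw [hSmul, hSpow, hSj]
  rw [← hSW, ← hSj] at hlin
  have h2 : truncShift δ hj.neg N (c τ₁) *
      truncShift δ hj.neg N (∑ a ∈ Finset.range N, x ^ a * c (z a)) =
      truncShift δ hj.neg N (truncShift δ hi.neg N (c τ₀)) := by rw [← hSmul, hW]
  have h3 : truncShift δ hj.neg N (c τ₁) * truncShift δ hj.neg N (c (z 0)) =
      truncShift δ hj.neg N (c τ₀) := by
    rw [← hSmul, ← map_mul, hz, negShiftCoeff_zero]
  -- The linear problem with denominators cleared: `hW`, `hEs`, `h2`, `h3` replace `ŵ`, `E`, `ŵ(t -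
  -- [y])` and `z₀(t - [y])` by tau functions.
  have hminus : (x - y) * truncShift δ hj.neg N (truncShift δ hi.neg N (c τ₀)) * c τ₁ =
      x * truncShift δ hi.neg N (c τ₀) * truncShift δ hj.neg N (c τ₁) -
      y * truncShift δ hj.neg N (c τ₀) * truncShift δ hi.neg N (c τ₁) := by
    linear_combination (-c τ₁ * truncShift δ hj.neg N (c τ₁)) * hlin - (x - y) * c τ₁ * h2 +
      x * truncShift δ hj.neg N (c τ₁) * hW -
      y * (c τ₁ * ∑ a ∈ Finset.range N, x ^ a * c (E a)) * h3 -
      y * truncShift δ hj.neg N (c τ₀) * hEs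
  have hadd := fun {v w : ℕ+ → MvPowerSeries σ ℝ} (hv : IsGraded v) (hw : IsGraded w)
    (u : TruncSeries σ R N) => (truncShift_add hδ hv hw u).symm
  -- Moving the base point by `B + [s_i] + [s_j]` turns all negative displacements into positive
  -- ones relative to `B`.
  have hS := congrArg (truncShift δ ((hB.add hi).add hj) N) hminus
  rw [map_sub, hSmul, hSmul, hSmul, hSmul, hSmul, hSmul, map_sub, hSx, hSy] at hS
  simp only [hadd] at hS
  simp only [hSC] at hS
  have e1 : B + bracket i + bracket j + (-bracket j + -bracket i) = B := by abel
  have e2 : B + bracket i + bracket j + -bracket i = B + bracket j := by abel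
  have e3 : B + bracket i + bracket j + -bracket j = B + bracket i := by abel
  rw [e1, e2, e3] at hS
  simpa only [map_mul, map_sub] using hS

/-- The elimination that derives the Fay identity from three-term identities; here `a`, `aᵢ`, `cᵢⱼ`
are the shifts of `τ₀` and `bᵢ`, `bᵢⱼ`, `d` those of `τ₁`. -/
theorem fay_elimination {K : Type*} [CommRing K] [IsDomain K]
    {s₀ s₁ s₂ s₃ a a₀ a₁ a₂ a₃ b₀ b₁ b₂ b₃ b₀₁ b₀₂ b₀₃ b₁₂ b₁₃ b₂₃ c₁₂ c₁₃ c₂₃ d : K}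
    (ha : a ≠ 0) (ha₁ : a₁ ≠ 0) (hb₁₃ : b₁₃ ≠ 0) (hs : s₁ ≠ s₃)
    (h₀₁ : (s₀ - s₁) * a * b₀₁ = s₀ * a₁ * b₀ - s₁ * a₀ * b₁)
    (h₀₂ : (s₀ - s₂) * a * b₀₂ = s₀ * a₂ * b₀ - s₂ * a₀ * b₂)
    (h₀₃ : (s₀ - s₃) * a * b₀₃ = s₀ * a₃ * b₀ - s₃ * a₀ * b₃)
    (h₁₂ : (s₁ - s₂) * a * b₁₂ = s₁ * a₂ * b₁ - s₂ * a₁ * b₂)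
    (h₁₃ : (s₁ - s₃) * a * b₁₃ = s₁ * a₃ * b₁ - s₃ * a₁ * b₃)
    (h₂₃ : (s₂ - s₃) * a * b₂₃ = s₂ * a₃ * b₂ - s₃ * a₂ * b₃)
    (g₃ : (s₁ - s₂) * a₃ * d = s₁ * c₂₃ * b₁₃ - s₂ * c₁₃ * b₂₃)
    (g₁ : (s₂ - s₃) * a₁ * d = s₂ * c₁₃ * b₁₂ - s₃ * c₁₂ * b₁₃) :
    s₁ * (s₀ - s₁) * (s₂ - s₃) * c₂₃ * b₀₁ + s₂ * (s₀ - s₂) * (s₃ - s₁) * c₁₃ * b₀₂ +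
        s₃ * (s₀ - s₃) * (s₁ - s₂) * c₁₂ * b₀₃ =
      (s₁ - s₂) * (s₂ - s₃) * (s₃ - s₁) * a₀ * d := by
  -- `k = 0` is the three-term relation for `τ₀` alone, `w = 0` the Fay identity at `s₀ = 0`. Both
  -- `a₃ w` and `a₁ w` are multiples of `k`; comparing them through `h₁₃` forces `k = 0`, then `w =
  -- 0`.
  set k := s₁ * (s₂ - s₃) * c₂₃ * a₁ + s₂ * (s₃ - s₁) * c₁₃ * a₂ + s₃ * (s₁ - s₂) * c₁₂ * a₃
    with hk
  set w := (s₁ - s₂) * (s₁ - s₃) * (s₂ - s₃) * a * d - s₁ ^ 2 * (s₂ - s₃) * c₂₃ * b₁ -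
    s₂ ^ 2 * (s₃ - s₁) * c₁₃ * b₂ - s₃ ^ 2 * (s₁ - s₂) * c₁₂ * b₃ with hw
  have e₃ : a₃ * w = -(s₃ * b₃ * k) := by
    rw [hw, hk]
    linear_combination (s₁ - s₃) * (s₂ - s₃) * a * g₃ + s₁ * c₂₃ * (s₂ - s₃) * h₁₃ -
      s₂ * c₁₃ * (s₁ - s₃) * h₂₃
  have e₁ : a₁ * w = -(s₁ * b₁ * k) := by
    rw [hw, hk]
    linear_combination (s₁ - s₂) * (s₁ - s₃) * a * g₁ + s₂ * c₁₃ * (s₁ - s₃) * h₁₂ -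
      s₃ * c₁₂ * (s₁ - s₂) * h₁₃
  have hk0 : k = 0 := by
    have h : ((s₁ - s₃) * a * b₁₃) * k = 0 := by
      rw [h₁₃]
      linear_combination a₃ * e₁ - a₁ * e₃
    exact (mul_eq_zero.1 h).resolve_left
      (mul_ne_zero (mul_ne_zero (sub_ne_zero.2 hs) ha) hb₁₃)
  have hw0 : w = 0 := by
    rw [hk0, mul_zero, neg_zero] at e₁
    exact (mul_eq_zero.1 e₁).resolve_left ha₁
  -- Inserting the identities with `s₀` into `a` times the left-hand side leaves `s₀ b₀ k` and `a₀`
  -- times the sum in `w`.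
  refine mul_left_cancel₀ ha ?_
  linear_combination s₁ * (s₂ - s₃) * c₂₃ * h₀₁ + s₂ * (s₃ - s₁) * c₁₃ * h₀₂ +
    s₃ * (s₁ - s₂) * c₁₂ * h₀₃ + s₀ * b₀ * (hk0 - hk) + a₀ * (hw0 - hw)

end Fay

/-! ### Application to solutions of the hierarchy -/

section Solutions

variable {U : Set Times} {𝕜 : Type*} [RCLike 𝕜]

theorem map_taylorSeries {σ : Type*} (hU : IsTimeDomain U) (f : smoothFunctions U 𝕜)
    (y : ℕ+ → MvPowerSeries σ ℝ) :
    MvPowerSeries.map (smoothFunctions U 𝕜).val.toRingHom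
      (taylorSeries (pdDerivation 𝕜 hU) f y) = taylorShift (f : DFun U 𝕜) y := by
  ext d : 1
  refine ((smoothFunctions U 𝕜).val.toLinearMap.toAddMonoidHom.map_finsum_of_injective
    Subtype.val_injective _).trans (finsum_congr fun l => ?_)
  have h : ((l.foldr (fun k g => pdDerivation 𝕜 hU k g) f : smoothFunctions U 𝕜) : DFun U 𝕜) =
      pdList l f := by
    induction l with
    | nil => rfl
    | cons k l ih => exact congrArg (pd k) ih
  rw [← h]
  rfl

/-- The coefficients of the dressing operator of a solution. -/
def IsSolution.smoothCoeff {L Z Zinv : PDO U 𝕜} (hsol : IsSolution L Z Zinv) (l : ℤ) :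
    smoothFunctions U 𝕜 := ⟨Z.coeff l, hsol.smooth l⟩

variable {L Z Zinv : PDO U 𝕜}

theorem IsSolution.smoothCoeff_eq_zero (hsol : IsSolution L Z Zinv) (l : ℤ) (hl : 0 < l) :
    hsol.smoothCoeff l = 0 := Subtype.ext (hsol.order_le_zero l hl)

theorem IsSolution.isUnit_smoothCoeff (hsol : IsSolution L Z Zinv) :
    IsUnit (hsol.smoothCoeff 0) := isUnit_smoothFunctions hsol.leading_ne_zero

theorem IsSolution.coe_iterate_deltaMul (hsol : IsSolution L Z Zinv) (j : ℕ) (l : ℤ) :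
    (((deltaMul shiftHom)^[j] hsol.smoothCoeff l : smoothFunctions U 𝕜) : DFun U 𝕜) =
      (fun (X : ℤ → DFun U 𝕜) (l : ℤ) => shift 1 (X (l - 1)) + diff (X l))^[j] Z.coeff l := by
  induction j generalizing l with
  | zero => rfl
  | succ j ih =>
    simp only [Function.iterate_succ_apply', ← ih]
    rfl

/-- From `L^k Z = Z Δ^k` and the Sato equations, `(∂_k + λ^k) Z = (L^k)_{≥1} Z`. The weights are
coefficients of `L^k`, whose smoothness is not part of the hypotheses; triangularity deduces it from
that of `Z`. -/
theorem IsSolution.twistedDeriv_mem (hU : IsTimeDomain U) (hsol : IsSolution L Z Zinv) (k : ℕ+) :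
    twistedDeriv (pdDerivation 𝕜 hU) k hsol.smoothCoeff ∈
      positiveSpan shiftHom hsol.smoothCoeff := by
  obtain ⟨N, hN⟩ := PDO.geOne_mul_coeff (L ^ (k : ℕ)) Z
  set φ := (smoothFunctions U 𝕜).val.toRingHom
  have hsum : ∀ l, φ (twistedDeriv (pdDerivation 𝕜 hU) k hsol.smoothCoeff l) =
      ∑ j ∈ Finset.range N, (L ^ (k : ℕ)).coeff (j + 1 : ℕ) *
        φ ((deltaMul shiftHom)^[j + 1] hsol.smoothCoeff l) := by
    intro l
    have h1 : (L ^ (k : ℕ) * Z).coeff l = Z.coeff (l - k) := by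
      rw [hsol.dressing, PDO.dressed_pow_mul hsol.inv_mul, PDO.mul_deltaPow_coeff]
    have h2 := hsol.sato k l
    have h3 : φ (twistedDeriv (pdDerivation 𝕜 hU) k hsol.smoothCoeff l) =
        pd k (Z.coeff l) + Z.coeff (l - k) := rfl
    rw [h3, h2, ← h1, PDO.coeff_mul_eq_add (L ^ (k : ℕ)) Z, neg_add_cancel_comm_assoc, hN]
    exact Finset.sum_congr rfl fun j _ => by rw [← hsol.coe_iterate_deltaMul]; rfl
  have hb : ∀ j < N, ∃ r, (L ^ (k : ℕ)).coeff (j + 1 : ℕ) = φ r := by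
    -- The index `l + 1` places the leading coefficient of `Δ^{j+1} Z` at `j`.
    refine mem_of_triangular_sum_mem φ
      (fun j l => (deltaMul shiftHom)^[j + 1] hsol.smoothCoeff (l + 1))
      (fun j l hl => iterate_deltaMul_eq_zero _ hsol.smoothCoeff_eq_zero _ _ ?_) (fun j => ?_) N
      (fun j => (L ^ (k : ℕ)).coeff (j + 1 : ℕ)) fun l => ⟨_, (hsum (l + 1)).symm⟩
    · push_cast
      omega
    · exact_mod_cast isUnit_iterate_deltaMul_leading (shiftHom (U := U) (𝕜 := 𝕜))
        hsol.smoothCoeff_eq_zero hsol.isUnit_smoothCoeff (j + 1)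
  choose! r hr using hb
  refine mem_positiveSpan_of_eq_sum N r fun l => Subtype.val_injective ?_
  refine ((hsum l).trans ?_).trans (map_sum φ _ _).symm
  exact Finset.sum_congr rfl fun j hj => by rw [hr j (Finset.mem_range.1 hj), ← map_mul]

theorem three_term_taylorShift {σ : Type*} (hU : IsTimeDomain U) (hsol : IsSolution L Z Zinv)
    {τ₀ τ₁ : DFun U 𝕜} (hτ : IsTauPair Z τ₀ τ₁) (i j : σ) {B : ℕ+ → MvPowerSeries σ ℝ}
    (hB : IsGraded B) :
    (MvPowerSeries.X i - MvPowerSeries.X j) * taylorShift τ₀ B *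
        taylorShift τ₁ (B + bracket i + bracket j) =
      MvPowerSeries.X i * taylorShift τ₀ (B + bracket j) * taylorShift τ₁ (B + bracket i) -
      MvPowerSeries.X j * taylorShift τ₀ (B + bracket i) * taylorShift τ₁ (B + bracket j) := by
  have hδ := pdDerivation_comm (𝕜 := 𝕜) hU
  obtain ⟨E, hE0, hE⟩ := exists_linear_problem (δ := pdDerivation 𝕜 hU) (γ := shiftHom)
    (D := negShiftCoeff (pdDerivation 𝕜 hU)) negShiftCoeff_zero negShiftCoeff_map_zero
    (succ_smul_negShiftCoeff hδ) (pdDerivation_shiftHom hU) (hsol.twistedDeriv_mem hU)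
    hsol.smoothCoeff_eq_zero hsol.isUnit_smoothCoeff
  have hz : ∀ m : ℕ, (⟨τ₁, hτ.smooth_one⟩ : smoothFunctions U 𝕜) *
      hsol.smoothCoeff (-(m : ℤ)) =
        negShiftCoeff (pdDerivation 𝕜 hU) m (⟨τ₀, hτ.smooth_zero⟩ : smoothFunctions U 𝕜) := by
    intro m
    apply Subtype.val_injective
    have h1 := congrArg (PowerSeries.coeff m) hτ.wave
    rw [PowerSeries.coeff_C_mul, waveHat, PowerSeries.coeff_mk] at h1
    have h2 : τ₁ * τ₁⁻¹ = 1 := by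
      funext n t
      exact mul_inv_cancel₀ (hτ.ne_zero_one n t)
    have h3 := map_taylorSeries hU (⟨τ₀, hτ.smooth_zero⟩ : smoothFunctions U 𝕜) (-bracket ())
    have h4 := congrArg (PowerSeries.coeff m) h3
    refine Eq.trans ?_ h4.symm
    calc τ₁ * Z.coeff (-(m : ℤ)) = (τ₁ * τ₁⁻¹) * PowerSeries.coeff m
          (taylorShift τ₀ (-bracket ())) := by rw [h1, mul_assoc]
      _ = _ := by rw [h2, one_mul]
  have h := three_term_identity hδ (z := fun m => hsol.smoothCoeff (-(m : ℤ)))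
    (isUnit_smoothFunctions hτ.ne_zero_zero) hE0 hE hz i j hB
  have h' := congrArg (MvPowerSeries.map (smoothFunctions U 𝕜).val.toRingHom) h
  simpa only [map_mul, map_sub, MvPowerSeries.map_X, map_taylorSeries] using h'

theorem coeff_zero_taylorShift {σ : Type*} (hU : IsTimeDomain U) {f : DFun U 𝕜} (hf : SmoothFn f)
    {y : ℕ+ → MvPowerSeries σ ℝ} (hy : IsGraded y) :
    MvPowerSeries.coeff 0 (taylorShift f y) = f := by
  rw [← map_taylorSeries hU ⟨f, hf⟩ y, MvPowerSeries.coeff_map, coeff_zero_taylorSeries hy]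
  rfl

/-- Evaluation of functions at `(n, t)`. -/
def evalAt (n : ℤ) (t : U) : DFun U 𝕜 →+* 𝕜 :=
  (Pi.evalRingHom (fun _ : U => 𝕜) t).comp (Pi.evalRingHom (fun _ : ℤ => U → 𝕜) n)

/-- Functions of `(n, t)` have zero divisors; pointwise evaluation leads to power series over the
field `𝕜`, where cancellation is possible. -/
theorem eq_of_forall_map_evalAt {σ : Type*} {φ ψ : MvPowerSeries σ (DFun U 𝕜)}
    (h : ∀ n t, MvPowerSeries.map (evalAt n t) φ = MvPowerSeries.map (evalAt n t) ψ) : φ = ψ := by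
  ext d n t
  exact congrArg (MvPowerSeries.coeff d) (h n t)

theorem map_evalAt_taylorShift_ne_zero {σ : Type*} (hU : IsTimeDomain U) {f : DFun U 𝕜}
    (hf : SmoothFn f) {n : ℤ} {t : U} (h0 : f n t ≠ 0) {y : ℕ+ → MvPowerSeries σ ℝ}
    (hy : IsGraded y) : MvPowerSeries.map (evalAt n t) (taylorShift f y) ≠ 0 := by
  intro h
  have h' := congrArg (MvPowerSeries.coeff 0) h
  rw [MvPowerSeries.coeff_map, coeff_zero_taylorShift hU hf hy, map_zero] at h'
  exact h0 h'

end Solutions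

end DMKP

end

theorem theorem3p1 {𝕜 : Type*} [RCLike 𝕜] (U : Set DMKP.Times) (hU : DMKP.IsTimeDomain U)
    (L Z Zinv : DMKP.PDO U 𝕜) (hsol : DMKP.IsSolution L Z Zinv)
    (τ₀ τ₁ : DMKP.DFun U 𝕜) (hτ : DMKP.IsTauPair Z τ₀ τ₁)
    (s : Fin 4 → MvPowerSeries (Fin 4) (DMKP.DFun U 𝕜)) (hs : s = MvPowerSeries.X)
    (br : Fin 4 → ℕ+ → MvPowerSeries (Fin 4) ℝ) (hbr : br = DMKP.bracket) :
    s 1 * (s 0 - s 1) * (s 2 - s 3) *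
          DMKP.taylorShift τ₀ (br 2 + br 3) * DMKP.taylorShift τ₁ (br 0 + br 1)
      + s 2 * (s 0 - s 2) * (s 3 - s 1) *
          DMKP.taylorShift τ₀ (br 3 + br 1) * DMKP.taylorShift τ₁ (br 0 + br 2)
      + s 3 * (s 0 - s 3) * (s 1 - s 2) *
          DMKP.taylorShift τ₀ (br 1 + br 2) * DMKP.taylorShift τ₁ (br 0 + br 3)
    = (s 1 - s 2) * (s 2 - s 3) * (s 3 - s 1) *
          DMKP.taylorShift τ₀ (br 0) * DMKP.taylorShift τ₁ (br 1 + br 2 + br 3) := by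
  have hg : ∀ i, DMKP.IsGraded (br i) := hbr ▸ DMKP.isGraded_bracket
  have h3 : ∀ (i j : Fin 4) (B : ℕ+ → MvPowerSeries (Fin 4) ℝ), DMKP.IsGraded B →
      (s i - s j) * DMKP.taylorShift τ₀ B * DMKP.taylorShift τ₁ (B + br i + br j) =
        s i * DMKP.taylorShift τ₀ (B + br j) * DMKP.taylorShift τ₁ (B + br i) -
        s j * DMKP.taylorShift τ₀ (B + br i) * DMKP.taylorShift τ₁ (B + br j) := by
    subst hs hbr
    exact fun i j B hB => DMKP.three_term_taylorShift hU hsol hτ i j hB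
  refine DMKP.eq_of_forall_map_evalAt fun n t => ?_
  have hev := fun (i j : Fin 4) B hB => congrArg (MvPowerSeries.map (DMKP.evalAt n t)) (h3 i j B hB)
  have hX : ∀ i, MvPowerSeries.map (DMKP.evalAt n t) (s i) = MvPowerSeries.X i := by
    intro i
    rw [hs, MvPowerSeries.map_X]
  simp only [map_mul, map_sub, map_add, hX] at hev ⊢
  -- Base point `0` gives the six identities for pairs of variables; base points `[s₃]` and `[s₁]`
  -- below give the two containing `τ₁(t + [s₁] + [s₂] + [s₃])`.
  have h0 := fun i j => hev i j 0 DMKP.isGraded_zero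
  simp only [zero_add] at h0
  have g₃ := hev 1 2 (br 3) (hg 3)
  have g₁ := hev 2 3 (br 1) (hg 1)
  rw [show br 3 + br 1 + br 2 = br 1 + br 2 + br 3 by abel, add_comm (br 3) (br 2)] at g₃
  rw [add_comm (br 1) (br 3)] at g₁
  have h13 := h0 1 3
  rw [add_comm (br 1) (br 3)] at h13
  have : IsDomain (MvPowerSeries (Fin 4) 𝕜) := NoZeroDivisors.to_isDomain _
  -- Shifted tau functions are nonzero series because their constant terms are the values of `τ₀`,
  -- `τ₁` at `(n, t)`.
  have hτ₀ {y} := DMKP.map_evalAt_taylorShift_ne_zero (σ := Fin 4) hU hτ.smooth_zero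
    (hτ.ne_zero_zero n t) (y := y)
  have hτ₁ {y} := DMKP.map_evalAt_taylorShift_ne_zero (σ := Fin 4) hU hτ.smooth_one
    (hτ.ne_zero_one n t) (y := y)
  exact DMKP.fay_elimination (hτ₀ DMKP.isGraded_zero) (hτ₀ (hg 1)) (hτ₁ ((hg 3).add (hg 1)))
    (MvPowerSeries.X_inj.not.2 (by decide))
    (h0 0 1) (h0 0 2) (h0 0 3) (h0 1 2) h13 (h0 2 3) g₃ g₁
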